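/- **Setting.** Let $D$ be a pair $(S,J)$ of an (enhanced) sign string of length $n$ and a state string: a row of $n$ symbols, each of which is $\circ$, $\times$, or a sign $\pm$ together with a state in $\{-1,0,1\}$ (for an ordinary sign string all symbols are signs with states). Signs $+$ / $-$ stand for edges oriented upwards / downwards, states $+1,-1,0$ for a flow line pointing downwards, upwards, or no flow line. Give each symbol a set of colours in $\{1,2,3\}$: $+$ with state $1,0,-1$ gets $\{1\},\{2\},\{3\}$; $-$ with state $1,0,-1$ gets $\{1,2\},\{1,3\},\{2,3\}$; $\circ$ gets $\emptyset$ and $\times$ gets $\{1,2,3\}$. Assume that each colour occurs at exactly $\ell$ positions. Then the positions with colour $c$, in increasing order, are column $c$ of a column-strict tableau of shape $(3^\ell)$; subtracting the row number from each entry and reading column $c$ from bottom to top gives a partition $\lambda^c$, and $\vec\lambda=(\lambda^1,\lambda^2,\lambda^3)$ is the $3$-multipartition of $(S,J)$. **Tableaux.** The residue of a node in row $r$ and column $q$ is $q-r+m$, where $m$ is the maximal number of non-zero rows of the $\lambda^c$. $\mathrm{Std}_k(\vec\lambda)$ is the set of fillings $\vec T$ of $\vec\lambda$ with numbers from $\{1,\dots,k\}$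 that increase strictly along rows and columns, and in which equal entries lie in different components and have the same residue. Order nodes by component, then by row. For $1\le j\le k$ let $N_1,\dots,N_s$ ($0\le s\le 3$) be the nodes with entry $j$, from left to right, and put $$\deg(\vec T^j)=\sum_{a=1}^{s}\bigl(\#\{\text{addable nodes}\}-\#\{\text{removable nodes}\}\bigr)-\tbinom{s}{2},$$ where for $N_a$ one counts addable/removable nodes strictly after $N_a$ with the residue of $N_a$, for the diagram formed by all nodes with entries $<j$ and $N_1,\dots,N_a$. The Brundan–Kleshchev–Wang degree is $\deg_{\mathrm{BKW}}(\vec T)=\sum_{j=1}^k\deg(\vec T^j)$. **Webs with flow.** A web with boundary $S$ is a plane diagram of oriented trivalent graphs (every trivalent vertex is a source or a sink), possibly with closed components, below a horizontal line that contains its boundary points; it is cut by heights into arcs (cups, caps) and vertices with one edge below and two above (splits) or two below and one above (merges). A flow is an oriented subgraph that contains exactly two of the three edges at each vertex, its lines running through the vertices. $W_S^J$ is the set of webs with boundary $S$ with a flow whose states at the boundary are $J$; diagrams are not identified up to isotopy. The weight $\mathrm{wt}$ of a web with flow is the sum of the weights of its arcs and vertices: a cup or cap whose left end has state $x$ has weight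 $x-1$ or $x+1$ respectively; a split has weight $0$ if its upper left state is larger than its upper right state and $-1$ otherwise; a merge has weight $1$ if its lower left state is larger than its lower right state and $0$ otherwise. Put $\deg_{\mathrm{wt}}=-\mathrm{wt}$. **The map $\iota$.** A divided power $F_i^{(j)}$ ($1\le i<n$, $j\ge 1$) acts on weights in $\{0,1,2,3\}^n$ by moving $j$ from position $i$ to position $i+1$. Weight $1$ is drawn as an upward edge, weight $2$ as a downward edge, nothing is drawn at $0$ and $3$, and the operator is drawn as the resulting arc, vertex, $H$ (with rung oriented from left to right), shift or empty shift. A string $F=F_{i_N}^{(j_N)}\cdots F_{i_1}^{(j_1)}$ that acts on the highest weight vector $v_{3^\ell}$ of weight $(3^\ell,0^{n-\ell})$, with all weights staying in $\{0,1,2,3\}$ and final weights those of $S$, gives a web $u=F\,v_{3^\ell}$ with boundary $S$. For a flow $f$ on $u$ extending $J$, the filling $\iota(u_f)$ is built in $N$ steps from the empty one: the $k$-th step adds a node filled with $k$ of residue $i_k$ (residue with shift $\ell$) to each component $c$ for which the colour $c$ is at position $i_k$ below, but not above, the $k$-th local picture. (For non-elliptic $u$, $F$ may be its string of Leclerc–Toffin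 generators; then $u_f$ runs through $B_S^J$.) **The map $g$.** For $\vec T\in\mathrm{Std}_k(\vec\lambda)$ and $0\le j\le k$ let $|T^c_j|_r$ be the number of nodes with entries $\le j$ in row $r$ of component $c$. The $j$-th weight diagram of $\vec T$ has at position $p\in\mathbb Z$ the symbol whose colours are those $c$ for which $p=|T^c_j|_r-(r-1)$ for some $r\ge 1$. $g(\vec T)$ is the web with flow obtained by connecting consecutive weight diagrams, from $j=0$ to $j=k$, by the same local pictures as above. **Statement.** The maps $\iota$ and $g$ are of degree $0$, and $\deg_{\mathrm{BKW}}$ is an isotopy invariant: 1. For every $F$ and every web with flow $u_f\in W_S^J$ on $u=F\,v_{3^\ell}$ as above, $\iota(u_f)\in\mathrm{Std}_N(\vec\lambda)$, where $N$ is the length of $F$, and $\deg_{\mathrm{BKW}}(\iota(u_f))=\deg_{\mathrm{wt}}(u_f)$. 2. For every $k$ and every $\vec T\in\mathrm{Std}_k(\vec\lambda)$, $g(\vec T)\in W_S^J$ and $\deg_{\mathrm{wt}}(g(\vec T))=\deg_{\mathrm{BKW}}(\vec T)$. 3. If $v_{f'}\in W_S^J$ is isotopic (relative to the boundary line) to $u_f$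 as in 1, then $\deg_{\mathrm{BKW}}(\iota(u_f))=\deg_{\mathrm{wt}}(v_{f'})$. In particular $\deg_{\mathrm{BKW}}(\iota(u_f))=\deg_{\mathrm{BKW}}(\iota(u'_{f'}))$ for any two isotopic $u_f$, $u'_{f'}$ as in 1 (possibly for different strings $F$, $F'$). 4. If $\vec T_1\in\mathrm{Std}_{k_1}(\vec\lambda)$ and $\vec T_2\in\mathrm{Std}_{k_2}(\vec\lambda)$ are such that $g(\vec T_1)$ and $g(\vec T_2)$ differ only by isotopies, then $\deg_{\mathrm{BKW}}(\vec T_1)=\deg_{\mathrm{BKW}}(\vec T_2)$. -/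

import Mathlib

namespace Sl3Web

/-! ### Strands, weight diagrams and boundary data -/

/-- Orientation of a (vertical) piece of an edge of a web: `up` is the sign `+`, `down` the
sign `-`. -/
inductive Orientation
  | up
  | down
  deriving DecidableEq

/-- Reversal of an orientation. -/
def Orientation.flip : Orientation → Orientation
  | .up => .down
  | .down => .up

/-- A vertical piece of an edge of a web with flow: its orientation (the sign) and its state,
which is `1` if the flow line points downwards, `-1` if it points upwards and `0` if there is no
flow line. -/
abbrev Strand := Orientation × SignType

/-- The colours of a strand. In terms of column-strict tableaux with three columns: the columns
that contain the number of the boundary point. A `+` lies in one column, a `-` in two. -/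
def strandColors : Strand → Finset (Fin 3)
  | (.up, .pos) => {0}
  | (.up, .zero) => {1}
  | (.up, .neg) => {2}
  | (.down, .pos) => {0, 1}
  | (.down, .zero) => {0, 2}
  | (.down, .neg) => {1, 2}

/-- Entries of `sl_3`-weight diagrams: `∘`, `×`, or a strand (a state, marked with `*` iff the
strand is oriented downwards). At `∘` and `×` there is no web. -/
inductive Symbol
  | circ
  | cross
  | strand (s : Strand)
  deriving DecidableEq

/-- The colours of an entry: none for `∘` and all three for `×`. -/
def Symbol.colors : Symbol → Finset (Fin 3)
  | .circ => ∅
  | .cross => Finset.univ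
  | .strand s => strandColors s

/-- The entry with a given set of colours. -/
def Symbol.ofColors (C : Finset (Fin 3)) : Symbol :=
  if C = Finset.univ then .cross
  else if C = {0} then .strand (.up, .pos)
  else if C = {1} then .strand (.up, .zero)
  else if C = {2} then .strand (.up, .neg)
  else if C = {0, 1} then .strand (.down, .pos)
  else if C = {0, 2} then .strand (.down, .zero)
  else if C = {1, 2} then .strand (.down, .neg)
  else .circ

/-- The strand at an entry, if there is one. -/
def Symbol.toStrand : Symbol → Option Strand
  | .strand s => some s
  | _ => none

/-- The strands of a row of entries, from left to right. A list `D` of entries is a pair `(S, J)`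
of an (enhanced) sign string and a state string; a sign string in the narrow sense is the case
where all entries are strands. -/
def strands (D : List Symbol) : List Strand := D.filterMap Symbol.toStrand

/-- The set of entries (in `1, …, n`) of column `c` of the column-strict tableau of `D = (S, J)`:
the number `t` is in column `c` iff `c` is a colour of the `t`-th entry of `D`. -/
def column (D : List Symbol) (c : Fin 3) : Finset ℕ :=
  (Finset.Icc 1 D.length).filter fun t => c ∈ (D.getD (t - 1) Symbol.circ).colors

/-! ### `3`-multipartitions and standard `3`-multitableaux -/

/-- `3`-multipartitions. The cell `(r, q)` of a component is in row `r` and column `q`, both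
counted from `0`. -/
abbrev MultiPartition := Fin 3 → YoungDiagram

/-- Nodes `(c, r, q)`: component, row, column. -/
abbrev Node := Fin 3 × ℕ × ℕ

/-- The `3`-multipartition of `D = (S, J)`. The entry `x` of column `c` of the tableau of `D`
sits in the row with number `i = #{x' ≤ x}`. Subtracting the row number gives a row of length
`x - i`, and as the column is read from bottom to top this is the row `#{x < x'}` of the component
`c` (rows counted from `0`). -/
def shape (D : List Symbol) : MultiPartition := fun c =>
  { cells :=
      (Finset.range (D.length + 1) ×ˢ Finset.range (D.length + 1)).filter fun p =>
        ∃ x ∈ column D c,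
          p.1 ≤ ((column D c).filter fun y => x < y).card ∧
          p.2 + ((column D c).filter fun y => y ≤ x).card < x
    isLowerSet := by
      rintro ⟨r, q⟩ ⟨r', q'⟩ hle h
      obtain ⟨h1, h2⟩ := Prod.mk_le_mk.mp hle
      simp only [Finset.coe_filter, Finset.mem_product, Finset.mem_range,
        Set.mem_ofPred_eq] at h ⊢
      obtain ⟨⟨ha, hb⟩, x, hx, hc, hd⟩ := h
      exact ⟨⟨by omega, by omega⟩, x, hx, by omega, by omega⟩ }

/-- The nodes of a `3`-multipartition. -/
def nodes (lam : MultiPartition) : Finset Node :=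
  Finset.univ.biUnion fun c => (lam c).cells.image fun p => (c, p)

/-- The largest number of (non-zero) rows of the components. -/
def maxRows (lam : MultiPartition) : ℕ := Finset.univ.sup fun c => (lam c).colLen 0

/-- The largest number of columns of the components. -/
def maxCols (lam : MultiPartition) : ℕ := Finset.univ.sup fun c => (lam c).rowLen 0

/-- The residue of a node: column minus row, shifted by `m`. -/
def residue (m : ℕ) (N : Node) : ℤ := (N.2.2 : ℤ) - (N.2.1 : ℤ) + (m : ℤ)

/-- A filling of nodes with positive numbers; the value `0` means that the node is not filled. -/
abbrev Filling := Node → ℕ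

/-- Standard `3`-multitableaux of shape `lam` with numbers from `{1, …, k}`: the entries increase
strictly along rows and columns, and equal entries are in different components and have the same
residue. -/
structure IsStandard (k : ℕ) (lam : MultiPartition) (T : Filling) : Prop where
  filled : ∀ N : Node, T N ≠ 0 ↔ N.2 ∈ lam N.1
  le : ∀ N : Node, T N ≤ k
  row_strict : ∀ (c : Fin 3) (r q₁ q₂ : ℕ), q₁ < q₂ → (r, q₂) ∈ lam c →
    T (c, r, q₁) < T (c, r, q₂)
  col_strict : ∀ (c : Fin 3) (r₁ r₂ q : ℕ), r₁ < r₂ → (r₂, q) ∈ lam c →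
    T (c, r₁, q) < T (c, r₂, q)
  repeated : ∀ M N : Node, T M ≠ 0 → T M = T N → M ≠ N →
    M.1 ≠ N.1 ∧ residue (maxRows lam) M = residue (maxRows lam) N

/-- The set `Std(lam)` of standard fillings with numbers from `{1, …, k}`. -/
def Std (k : ℕ) (lam : MultiPartition) : Set Filling := {T | IsStandard k lam T}

/-! ### The degree of a tableau -/

/-- A set of nodes is the diagram of a (multi)partition. -/
def IsDiagram (E : Set Node) : Prop := ∀ c : Fin 3, IsLowerSet {p : ℕ × ℕ | (c, p) ∈ E}

/-- The node `N` can be added to the diagram `E`. -/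
def IsAddable (E : Set Node) (N : Node) : Prop := N ∉ E ∧ IsDiagram (insert N E)

/-- The node `N` can be removed from the diagram `E`. -/
def IsRemovable (E : Set Node) (N : Node) : Prop := N ∈ E ∧ IsDiagram (E \ {N})

/-- `M` comes strictly after `N`. -/
def StrictlyAfter (M N : Node) : Prop := N.1 < M.1 ∨ (N.1 = M.1 ∧ N.2.1 < M.2.1)

/-- The nodes filled with the number `j`. -/
def nodesWith (lam : MultiPartition) (T : Filling) (j : ℕ) : Finset Node :=
  (nodes lam).filter fun N => T N = j

/-- The diagram of all nodes with entries smaller than that of `N`, together with the nodes with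
the same entry up to and including `N`, where the nodes with the same number are added
one by one, starting from the leftmost component. -/
def diagramAt (lam : MultiPartition) (T : Filling) (N : Node) : Set Node :=
  {M | M ∈ nodes lam ∧ (T M < T N ∨ (T M = T N ∧ M.1 ≤ N.1))}

/-- The shift that accounts for divided powers. -/
def dividedShift : ℕ → ℤ
  | 2 => 1
  | 3 => 3
  | _ => 0

/-- The contribution to the degree of a single node: addable minus removable nodes of the same
residue strictly after it. -/
noncomputable def nodeDegree (lam : MultiPartition) (T : Filling) (N : Node) : ℤ :=
  ({M | IsAddable (diagramAt lam T N) M ∧ StrictlyAfter M N ∧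
      residue (maxRows lam) M = residue (maxRows lam) N}.ncard : ℤ) -
  ({M | IsRemovable (diagramAt lam T N) M ∧ StrictlyAfter M N ∧
      residue (maxRows lam) M = residue (maxRows lam) N}.ncard : ℤ)

/-- The degree of the `j`-th step. -/
noncomputable def stepDegree (lam : MultiPartition) (T : Filling) (j : ℕ) : ℤ :=
  (∑ N ∈ nodesWith lam T j, nodeDegree lam T N) - dividedShift (nodesWith lam T j).card

/-- The Brundan–Kleshchev–Wang degree of a `3`-multitableau of shape `lam` with numbers from
`{1, …, k}`. -/
noncomputable def degBKW (k : ℕ) (lam : MultiPartition) (T : Filling) : ℤ :=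
  ∑ j ∈ Finset.Icc 1 k, stepDegree lam T j

/-! ### Webs, flows and weights -/

/-- Elementary pieces of a plane web diagram, with edges labelled in `α`: arcs `cup` and `cap`
(local minima and maxima), trivalent vertices `split a b c` with one edge `a` below and two edges
`b, c` above (from left to right), and `merge a b c` with two edges `a, b` below and one edge `c`
above. -/
inductive Piece (α : Type)
  | cup (a b : α)
  | cap (a b : α)
  | split (a b c : α)
  | merge (a b c : α)

namespace Piece

variable {α β : Type}

/-- The edges at the bottom of a piece. -/
def bottom : Piece α → List α
  | cup _ _ => []
  | cap a b => [a, b]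
  | split a _ _ => [a]
  | merge a b _ => [a, b]

/-- The edges at the top of a piece. -/
def top : Piece α → List α
  | cup a b => [a, b]
  | cap _ _ => []
  | split _ b c => [b, c]
  | merge _ _ c => [c]

/-- Relabelling. -/
def map (f : α → β) : Piece α → Piece β
  | cup a b => cup (f a) (f b)
  | cap a b => cap (f a) (f b)
  | split a b c => split (f a) (f b) (f c)
  | merge a b c => merge (f a) (f b) (f c)

/-- Orientations: an arc is oriented consistently, and a trivalent vertex is a source or a sink. -/
def IsWeb : Piece Orientation → Prop
  | cup a b => b = a.flip
  | cap a b => b = a.flip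
  | split a b c => b = a.flip ∧ c = a.flip
  | merge a b c => b = a ∧ c = a.flip

/-- Flows: a flow line runs through an arc or the arc has none, and at a trivalent vertex exactly
two of the three edges belong to the flow, one flow line running through the vertex. -/
def IsFlow : Piece SignType → Prop
  | cup a b => (a : ℤ) + (b : ℤ) = 0
  | cap a b => (a : ℤ) + (b : ℤ) = 0
  | split a b c => (a : ℤ) = (b : ℤ) + (c : ℤ) ∧ [a, b, c].count 0 = 1
  | merge a b c => (c : ℤ) = (a : ℤ) + (b : ℤ) ∧ [a, b, c].count 0 = 1

/-- The Khovanov–Kuperberg weight of an arc or a trivalent vertex with flow. -/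
def weight : Piece SignType → ℤ
  | cup a _ => (a : ℤ) - 1
  | cap a _ => (a : ℤ) + 1
  | split _ b c => if c < b then 0 else -1
  | merge a b _ => if b < a then 1 else 0

end Piece

/-- A horizontal slice of a plane diagram: one elementary piece, with vertical edges to its left
and to its right. -/
structure Slice (α : Type) where
  left : List α
  piece : Piece α
  right : List α

namespace Slice

variable {α β : Type}

/-- The row of edges at the bottom of a slice. -/
def bottom (s : Slice α) : List α := s.left ++ s.piece.bottom ++ s.right

/-- The row of edges at the top of a slice. -/
def top (s : Slice α) : List α := s.left ++ s.piece.top ++ s.right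

/-- Relabelling. -/
def map (f : α → β) (s : Slice α) : Slice β :=
  ⟨s.left.map f, s.piece.map f, s.right.map f⟩

end Slice

/-- The slices, stacked from bottom to top, fit together and lead from the row `x` to the
row `y`. -/
def Connects {α : Type} : List α → List (Slice α) → List α → Prop
  | x, [], y => x = y
  | x, s :: w, y => s.bottom = x ∧ Connects s.top w y

/-- The set of all webs with flow with boundary datum `D = (S, J)`: plane diagrams, cut into
slices from bottom to top, with all their boundary points on the horizontal line on top of the
diagram. Diagrams are not identified up to isotopy. -/
def flowWebs (D : List Symbol) : Set (List (Slice Strand)) :=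
  {u | (∀ s ∈ u, (s.piece.map Prod.fst).IsWeb) ∧ (∀ s ∈ u, (s.piece.map Prod.snd).IsFlow) ∧
    Connects [] u (strands D)}

/-- The web underlying a web with flow. -/
def underlyingWeb (u : List (Slice Strand)) : List (Slice Orientation) :=
  u.map (Slice.map Prod.fst)

/-- The weight of a web with flow: the sum of the weights of all arcs and all vertices. -/
def weight (u : List (Slice Strand)) : ℤ := (u.map fun s => (s.piece.map Prod.snd).weight).sum

/-- The degree of a web with flow: minus its weight. -/
def degWt (u : List (Slice Strand)) : ℤ := -weight u

/-! ### Isotopies -/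

/-- The elementary plane isotopies of diagrams cut into slices: exchanging the heights of two
distant pieces, straightening an edge (two forms), and turning a leg of a trivalent vertex (to the
right, to the left). -/
inductive IsotopyMove : List (Slice Strand) → List (Slice Strand) → Prop
  | exchange (L M R : List Strand) (p q : Piece Strand) :
      IsotopyMove
        [⟨L, p, M ++ q.bottom ++ R⟩, ⟨L ++ p.top ++ M, q, R⟩]
        [⟨L ++ p.bottom ++ M, q, R⟩, ⟨L, p, M ++ q.top ++ R⟩]
  | straighten_right (L R : List Strand) (a b : Strand) :
      IsotopyMove [⟨L ++ [a], .cup b a, R⟩, ⟨L, .cap a b, a :: R⟩] []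
  | straighten_left (L R : List Strand) (a b : Strand) :
      IsotopyMove [⟨L, .cup a b, a :: R⟩, ⟨L ++ [a], .cap b a, R⟩] []
  | turn_right (L R : List Strand) (a b c d : Strand) :
      IsotopyMove [⟨L, .merge a b c, R⟩]
        [⟨L, .split a c d, b :: R⟩, ⟨L ++ [c], .cap d b, R⟩]
  | turn_left (L R : List Strand) (a b c d : Strand) :
      IsotopyMove [⟨L, .merge a b c, R⟩]
        [⟨L ++ [a], .split b d c, R⟩, ⟨L, .cap a d, c :: R⟩]

/-- Two webs with flow with boundary datum `D` are isotopic relative to the boundary line: they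
are related by a finite sequence of elementary isotopies and their inverses, each applied to
some consecutive slices, through webs with flow. -/
def Isotopic (D : List Symbol) : List (Slice Strand) → List (Slice Strand) → Prop :=
  Relation.EqvGen fun u v => u ∈ flowWebs D ∧ v ∈ flowWebs D ∧
    ∃ below x y above, IsotopyMove x y ∧
      u = below ++ x ++ above ∧ v = below ++ y ++ above

/-- The local picture that connects two consecutive rows of a ladder at two neighbouring
positions, from the strands `x` at the bottom to the strands `y` on top, between strands `L` on
the left and `R` on the right: an arc, a vertex, an `H` with the given rung (drawn with a rung that
goes up from left to right), or nothing to draw if it is a shift of one strand or an empty shift. -/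
def connect {α : Type} (L R : List α) (rung : α) : List α → List α → List (Slice α)
  | [], [a, b] => [⟨L, .cup a b, R⟩]
  | [a, b], [] => [⟨L, .cap a b, R⟩]
  | [a], [b, c] => [⟨L, .split a b c, R⟩]
  | [a, b], [c] => [⟨L, .merge a b c, R⟩]
  | [a, b], [c, d] => [⟨L, .split a c rung, b :: R⟩, ⟨L ++ [c], .merge rung b d, R⟩]
  | _, _ => []

/-! ### Webs obtained from divided powers, and the map `ι` -/

/-- A string of divided powers `F_i^(j)`, as a list of pairs `(i, j)` in the order in which they
act. -/
abbrev FString := List (ℕ × ℕ)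

/-- The weight vector (at the positions `1, 2, …`) after acting with the string `F` on the highest
weight vector of weight `(3^ℓ)`. The operator `F_i^(j)` moves `j` from position `i` to position
`i + 1`. -/
def weightsAfter (ℓ : ℕ) (F : FString) : ℕ → ℕ :=
  F.foldl (fun w f t => if t = f.1 then w t - f.2 else if t = f.1 + 1 then w t + f.2 else w t)
    (fun t => if 1 ≤ t ∧ t ≤ ℓ then 3 else 0)

/-- All steps of the string act between positions in `1, …, n` and keep the weights in
`{0, 1, 2, 3}`. -/
def IsAdmissible (ℓ n : ℕ) (F : FString) : Prop :=
  ∀ k < F.length, 1 ≤ (F.getD k (0, 0)).1 ∧ (F.getD k (0, 0)).1 < n ∧ 1 ≤ (F.getD k (0, 0)).2 ∧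
    (F.getD k (0, 0)).2 ≤ weightsAfter ℓ (F.take k) (F.getD k (0, 0)).1 ∧
    weightsAfter ℓ (F.take k) ((F.getD k (0, 0)).1 + 1) + (F.getD k (0, 0)).2 ≤ 3

/-- A weight `1` is an edge oriented upwards, `2` an edge oriented downwards, and at the weights `0`
and `3` the edges are erased. -/
def orientationOfWeight : ℕ → Option Orientation
  | 1 => some .up
  | 2 => some .down
  | _ => none

/-- The orientations of the edges at a list of positions. -/
def orientations (w : ℕ → ℕ) (l : List ℕ) : List Orientation :=
  l.filterMap fun t => orientationOfWeight (w t)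

/-- The web `F v_{3^ℓ}` with at most `n` boundary points: one local picture for each divided power.
The rung of an `H` is oriented from left to right. -/
def ladderWeb (ℓ n : ℕ) (F : FString) : List (Slice Orientation) :=
  (List.range F.length).flatMap fun k =>
    let i := (F.getD k (0, 0)).1
    connect
      (orientations (weightsAfter ℓ (F.take k)) (List.range' 1 (i - 1)))
      (orientations (weightsAfter ℓ (F.take k)) (List.range' (i + 2) (n - (i + 1))))
      .up
      (orientations (weightsAfter ℓ (F.take k)) [i, i + 1])
      (orientations (weightsAfter ℓ (F.take (k + 1))) [i, i + 1])

/-- The set of webs with flow with boundary datum `D` whose underlying web is `F v_{3^ℓ}`. Here `F`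
is any string of divided powers. For a non-elliptic web `u` it may in particular be the string of
Leclerc–Toffin generators of `u`, which gives all flows on `u` with boundary datum `D`. -/
def ladderFlowWebs (ℓ : ℕ) (F : FString) (D : List Symbol) : Set (List (Slice Strand)) :=
  {u | u ∈ flowWebs D ∧ IsAdmissible ℓ D.length F ∧
    (∀ t < D.length, weightsAfter ℓ F (t + 1) = (D.getD t Symbol.circ).colors.card) ∧
    underlyingWeb u = ladderWeb ℓ D.length F}

/-- The row of strands of `u` above the first `h` slices. -/
def rowAt (u : List (Slice Strand)) (h : ℕ) : List Strand :=
  ((u.take h).getLast?.map Slice.top).getD []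

/-- The colours at position `t` of the web with flow `u` on `F v_{3^ℓ}`, after the first `k` steps. -/
def colorsAt (ℓ n : ℕ) (F : FString) (u : List (Slice Strand)) (k t : ℕ) : Finset (Fin 3) :=
  if weightsAfter ℓ (F.take k) t = 0 then ∅
  else if weightsAfter ℓ (F.take k) t = 3 then Finset.univ
  else (((rowAt u (ladderWeb ℓ n (F.take k)).length)[
    (orientations (weightsAfter ℓ (F.take k)) (List.range' 1 (t - 1))).length]?).map
      strandColors).getD ∅

/-- The components to which the `(k + 1)`-st step adds a node, read off from the type (the
orientations) and the colour (the flow) of its local picture: `F_i^(j)` adds one to each component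
whose colour is at position `i` below the step, but not above it. -/
def movedColors (ℓ n : ℕ) (F : FString) (u : List (Slice Strand)) (k : ℕ) : Finset (Fin 3) :=
  colorsAt ℓ n F u k (F.getD k (0, 0)).1 \ colorsAt ℓ n F u (k + 1) (F.getD k (0, 0)).1

open Classical in
/-- Add nodes filled with `k` to the components in `M`, at the free place of residue `i` such that
the result is still a diagram. -/
noncomputable def addNodes (ℓ : ℕ) (T : Filling) (k i : ℕ) (M : Finset (Fin 3)) : Filling :=
  fun N => if N.1 ∈ M ∧ residue ℓ N = i ∧ IsAddable {N' | T N' ≠ 0} N then k else T N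

/-- The first `k` steps of the construction of the filling of a web with flow `u` on
`F v_{3^ℓ}`. -/
noncomputable def iotaSteps (ℓ n : ℕ) (F : FString) (u : List (Slice Strand)) : ℕ → Filling
  | 0 => fun _ => 0
  | k + 1 => addNodes ℓ (iotaSteps ℓ n F u k) (k + 1) (F.getD k (0, 0)).1 (movedColors ℓ n F u k)

/-- The map `ι` from webs with flow `u` on `F v_{3^ℓ}` to fillings of `3`-multipartitions. -/
noncomputable def iota (ℓ n : ℕ) (F : FString) (u : List (Slice Strand)) : Filling :=
  iotaSteps ℓ n F u F.length

/-! ### The extended growth algorithm `g` -/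

/-- The number of nodes in row `r` of component `c` with entries at most `j`. -/
def rowCount (lam : MultiPartition) (T : Filling) (j : ℕ) (c : Fin 3) (r : ℕ) : ℕ :=
  ((Finset.range ((lam c).rowLen r)).filter fun q => T (c, r, q) ≤ j).card

open Classical in
/-- The components `c` such that the integer `l` is an entry of the tuple
`(|T_j^c|_1, |T_j^c|_2 - 1, |T_j^c|_3 - 2, …)`. -/
noncomputable def towerColors (lam : MultiPartition) (T : Filling) (j : ℕ) (l : ℤ) :
    Finset (Fin 3) :=
  Finset.univ.filter fun c => ∃ r : ℕ, l = (rowCount lam T j c r : ℤ) - (r : ℤ)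

/-- The entry at position `l` of the `j`-th weight diagram of the tower of `T`. -/
noncomputable def tower (lam : MultiPartition) (T : Filling) (j : ℕ) (l : ℤ) : Symbol :=
  Symbol.ofColors (towerColors lam T j l)

/-- The strands at a list of positions of the `j`-th weight diagram. -/
noncomputable def towerStrands (lam : MultiPartition) (T : Filling) (j : ℕ) (l : List ℤ) :
    List Strand :=
  strands (l.map (tower lam T j))

/-- The positions of the weight diagrams that can carry strands: all positions to the left of these
are `×` and all positions to the right are `∘`. -/
def window (lam : MultiPartition) : List ℤ :=
  (List.range (maxRows lam + maxCols lam)).map fun t => (t : ℤ) - (maxRows lam : ℤ) + 1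

/-- The positions `p = column - row` of the nodes filled with `j`: the step from `j - 1` to `j`
takes place at the positions `p` and `p + 1`. For a standard tableau there is only one `p`, or
none if no node is filled with `j`. -/
def stepPositions (lam : MultiPartition) (T : Filling) (j : ℕ) : List ℤ :=
  ((nodesWith lam T j).image (residue 0)).sort (· ≤ ·)

/-- The strand that moves in step `j`. It is drawn as the rung of an `H`. -/
def rungStrand (lam : MultiPartition) (T : Filling) (j : ℕ) : Strand :=
  (Symbol.ofColors ((nodesWith lam T j).image Prod.fst)).toStrand.getD (.up, .zero)

/-- The extended growth algorithm `g`: the web with flow obtained by connecting the entries of the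
tower of weight diagrams of `T`. -/
noncomputable def growth (k : ℕ) (lam : MultiPartition) (T : Filling) : List (Slice Strand) :=
  (List.range k).flatMap fun j => (stepPositions lam T (j + 1)).flatMap fun p =>
    connect
      (towerStrands lam T j ((window lam).filter fun l => l < p))
      (towerStrands lam T j ((window lam).filter fun l => p + 1 < l))
      (rungStrand lam T (j + 1))
      (towerStrands lam T j [p, p + 1])
      (towerStrands lam T (j + 1) [p, p + 1])

end Sl3Web

open Sl3Web

/-!
Both degrees are computed step by step on an abacus with three runners, one for each colour. The
beads of the runner `c` are the positions `f r - r`, where `f r` is the length of row `r` of the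
component `c` (`beads`). For the multipartition of `D` these are the entries of column `c`, shifted
by `ℓ`, together with all positions further to the left (`beads_rowLen_shape`); hence the `j`-th
weight diagram of a tableau lists the colours that have a bead at each position.

A step of a tableau adds one node of residue `p` to each component in a set `M`, that is, it moves
the colours `M` from position `p` to position `p + 1`. A component has at most one addable or
removable node of a given residue; it is addable if there is a bead at `p` and none at `p + 1`, and
removable in the opposite case (`ncard_addable`, `ncard_removable`). So the degree of the step only
depends on `M` and on the colours `A`, `B` at `p` and `p + 1`: it is `localDeg A B M`
(`stepDegree_eq_localDeg`). The local picture drawn for the step is a web with flow of weight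
`-localDeg A B M`, which is a finite check over all `A`, `B`, `M` (`localPicture_spec`). Summing
over all steps gives the claim for `g` (`growth_spec`).

Conversely, on the local picture of a divided power with flow the flow condition says that some
colours `M` leave the left position and arrive at the right one, and the weight is again
`-localDeg A B M` (`isColorStep_of_flow`, `ladder_step`). By induction, the nodes filled in the
first `k` steps of `ι` form the diagram with the beads prescribed by the `k`-th row of the ladder
(`exists_rows_iotaSteps`), so `ι(u)` is standard of the right shape, and its degree is the sum of
the same local degrees (`stepDegree_iota`, `degBKW_iota`).

The weight is preserved by every elementary isotopy (`weight_eq_of_isotopyMove`), which gives the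
statements on isotopy invariance.
-/

namespace Sl3Web

/-! ### Stacking slices -/

theorem connects_append {α : Type} (x z : List α) (u v : List (Slice α)) :
    Connects x (u ++ v) z ↔ ∃ y, Connects x u y ∧ Connects y v z := by
  induction u generalizing x with
  | nil => simp [Connects]
  | cons s u ih => simp [Connects, ih, and_assoc]

/-- A slice, moved between further vertical edges. -/
def Slice.frame {α : Type} (L R : List α) (s : Slice α) : Slice α :=
  ⟨L ++ s.left, s.piece, s.right ++ R⟩

theorem connects_frame {α : Type} (L R x y : List α) (u : List (Slice α))
    (h : Connects x u y) : Connects (L ++ x ++ R) (u.map (Slice.frame L R)) (L ++ y ++ R) := by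
  induction u generalizing x with
  | nil => simpa [Connects] using h
  | cons s u ih =>
    obtain ⟨rfl, h⟩ := h
    refine ⟨by simp [Slice.frame, Slice.bottom], ?_⟩
    have := ih _ h
    simpa [Slice.frame, Slice.top] using this

theorem connect_eq_frame {α : Type} (L R : List α) (rung : α) (x y : List α) :
    connect L R rung x y = (connect [] [] rung x y).map (Slice.frame L R) := by
  unfold connect
  split <;> simp [Slice.frame]

theorem weight_append (u v : List (Slice Strand)) : weight (u ++ v) = weight u + weight v := by
  simp [weight]

theorem weight_map_frame (L R : List Strand) (u : List (Slice Strand)) :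
    weight (u.map (Slice.frame L R)) = weight u := by
  simp [weight, Function.comp_def, Slice.frame]

/-! ### The weight is invariant under isotopies -/

instance (p : Piece Orientation) : Decidable p.IsWeb := by
  cases p <;> unfold Piece.IsWeb <;> infer_instance

instance (p : Piece SignType) : Decidable p.IsFlow := by
  cases p <;> unfold Piece.IsFlow <;> infer_instance

theorem weight_turn_right (a b c d : SignType) :
    (Piece.merge a b c).IsFlow → (Piece.split a c d).IsFlow → (Piece.cap d b).IsFlow →
      (Piece.merge a b c).weight = (Piece.split a c d).weight + (Piece.cap d b).weight := by
  revert a b c d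
  decide

theorem weight_turn_left (a b c d : SignType) :
    (Piece.merge a b c).IsFlow → (Piece.split b d c).IsFlow → (Piece.cap a d).IsFlow →
      (Piece.merge a b c).weight = (Piece.split b d c).weight + (Piece.cap a d).weight := by
  revert a b c d
  decide

/-- Except for the exchange of heights, this uses that both sides are webs with flow. -/
theorem weight_eq_of_isotopyMove {x y : List (Slice Strand)} (h : IsotopyMove x y)
    (hx : ∀ s ∈ x, (s.piece.map Prod.snd).IsFlow) (hy : ∀ s ∈ y, (s.piece.map Prod.snd).IsFlow) :
    weight x = weight y := by
  cases h with
  | exchange L M R p q => simp [weight, add_comm]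
  | straighten_right L R a b =>
    simp [Piece.map, Piece.IsFlow, weight, Piece.weight] at hx ⊢
    omega
  | straighten_left L R a b =>
    simp [Piece.map, Piece.IsFlow, weight, Piece.weight] at hx ⊢
    omega
  | turn_right L R a b c d =>
    simp only [Piece.map, weight, List.mem_cons, List.not_mem_nil, or_false, forall_eq_or_imp,
      forall_eq, List.map_cons, List.map_nil, List.sum_cons, List.sum_nil, add_zero] at hx hy ⊢
    exact weight_turn_right a.2 b.2 c.2 d.2 hx hy.1 hy.2
  | turn_left L R a b c d =>
    simp only [Piece.map, weight, List.mem_cons, List.not_mem_nil, or_false, forall_eq_or_imp,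
      forall_eq, List.map_cons, List.map_nil, List.sum_cons, List.sum_nil, add_zero] at hx hy ⊢
    exact weight_turn_left a.2 b.2 c.2 d.2 hx hy.1 hy.2

theorem degWt_eq_of_isotopic {D : List Symbol} {u v : List (Slice Strand)}
    (h : Isotopic D u v) : degWt u = degWt v := by
  unfold Isotopic at h
  induction h with
  | refl => rfl
  | symm _ _ _ ih => exact ih.symm
  | trans _ _ _ _ _ ih₁ ih₂ => exact ih₁.trans ih₂
  | rel u v h =>
    obtain ⟨hu, hv, below, x, y, above, hxy, rfl, rfl⟩ := h
    have := weight_eq_of_isotopyMove hxy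
      (fun s hs => hu.2.1 s (by simp [hs])) (fun s hs => hv.2.1 s (by simp [hs]))
    simp [degWt, weight_append, this]

/-! ### Local pictures -/

theorem ofColors_colors (s : Symbol) : Symbol.ofColors s.colors = s := by
  rcases s with _ | _ | ⟨_ | _, _ | _ | _⟩ <;> decide

instance Connects.decidable {α : Type} [DecidableEq α] :
    (x : List α) → (u : List (Slice α)) → (y : List α) → Decidable (Connects x u y)
  | x, [], y => inferInstanceAs (Decidable (x = y))
  | x, s :: w, y =>
    have := Connects.decidable s.top w y
    inferInstanceAs (Decidable (s.bottom = x ∧ Connects s.top w y))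

/-- The degree of a step that moves the colours `M` from a position with colours `A` to the next
position, with colours `B`. -/
def localDeg (A B M : Finset (Fin 3)) : ℤ :=
  (∑ c ∈ M, ((((A \ B).filter (c < ·)).card : ℤ) - (((B \ A).filter (c < ·)).card : ℤ)))
    - dividedShift M.card

/-- The local picture of a step that moves the colours `M` from a position with colours `A` to the
next position, with colours `B`. -/
def localPicture (A B M : Finset (Fin 3)) : List (Slice Strand) :=
  connect [] [] ((Symbol.ofColors M).toStrand.getD (.up, .zero))
    (strands [Symbol.ofColors A, Symbol.ofColors B])
    (strands [Symbol.ofColors (A \ M), Symbol.ofColors (B ∪ M)])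

/-- A finite check over all sets of colours. -/
theorem localPicture_spec (A B M : Finset (Fin 3)) (hne : M.Nonempty) (hA : M ⊆ A)
    (hB : Disjoint M B) :
    (∀ s ∈ localPicture A B M, (s.piece.map Prod.fst).IsWeb) ∧
    (∀ s ∈ localPicture A B M, (s.piece.map Prod.snd).IsFlow) ∧
    Connects (strands [Symbol.ofColors A, Symbol.ofColors B]) (localPicture A B M)
      (strands [Symbol.ofColors (A \ M), Symbol.ofColors (B ∪ M)]) ∧
    weight (localPicture A B M) = -localDeg A B M := by
  revert A B M
  decide +kernel

/-! ### Row lengths and beads -/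

/-- The set of nodes of the diagram whose component `c` has rows of lengths `f c 0, f c 1, …`. -/
def rowsDiagram (f : Fin 3 → ℕ → ℕ) : Set Node := {N | N.2.2 < f N.1 N.2.1}

/-- The positions of the beads on the abacus of a partition with row lengths `f 0, f 1, …`: its
beta-numbers, normalised such that the empty partition has its beads at `l ≤ 0`. -/
def beads (f : ℕ → ℕ) : Set ℤ := Set.range fun r : ℕ => (f r : ℤ) - r

theorem mem_beads {f : ℕ → ℕ} {l : ℤ} : l ∈ beads f ↔ ∃ r : ℕ, (f r : ℤ) - r = l := Iff.rfl

theorem strictAnti_bead {f : ℕ → ℕ} (hf : Antitone f) :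
    StrictAnti fun r : ℕ => (f r : ℤ) - r := by
  intro a b hab
  have := hf hab.le
  simp only
  omega

theorem row_eq_of_bead_eq {f : ℕ → ℕ} (hf : Antitone f) {r s : ℕ}
    (h : (f r : ℤ) - r = (f s : ℤ) - s) : r = s :=
  (strictAnti_bead hf).injective h

/-- Row `r` can be extended iff there is no bead directly after its bead. -/
theorem forall_lt_row_iff {f : ℕ → ℕ} (hf : Antitone f) (r : ℕ) :
    (∀ r' < r, f r < f r') ↔ (f r : ℤ) - r + 1 ∉ beads f := by
  rw [mem_beads]
  constructor
  · rintro h ⟨s, hs⟩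
    have hsr : s < r := by
      by_contra hc
      have := hf (not_lt.mp hc)
      omega
    have := h (r - 1) (by omega)
    have := hf (show s ≤ r - 1 by omega)
    omega
  · intro h r' hr'
    have h1 := hf (show r - 1 ≤ r by omega)
    have h2 := hf (show r' ≤ r - 1 by omega)
    by_contra hc
    exact h ⟨r - 1, by omega⟩

/-- Row `r` can be shortened iff there is no bead directly before its bead. -/
theorem succ_row_lt_iff {f : ℕ → ℕ} (hf : Antitone f) (r : ℕ) :
    f (r + 1) < f r ↔ (f r : ℤ) - r - 1 ∉ beads f := by
  rw [mem_beads]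
  constructor
  · rintro h ⟨s, hs⟩
    have hsr : r < s := by
      by_contra hc
      have := hf (not_lt.mp hc)
      omega
    have := hf (show r + 1 ≤ s by omega)
    omega
  · intro h
    have h1 := hf (show r ≤ r + 1 by omega)
    by_contra hc
    exact h ⟨r + 1, by push_cast; omega⟩

/-- Adding the node in row `r` and column `q` moves a bead from `q - r` to the free position
`q - r + 1`. -/
theorem beads_of_add_node {f f' : ℕ → ℕ} (hf : Antitone f) (hf' : Antitone f') {r q : ℕ}
    (h : ∀ r' q', q' < f' r' ↔ q' < f r' ∨ (r' = r ∧ q' = q)) (hq : ¬ q < f r) :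
    (q : ℤ) - r ∈ beads f ∧ (q : ℤ) - r + 1 ∉ beads f ∧
    ∀ l, l ∈ beads f' ↔ (l ∈ beads f ∧ l ≠ (q : ℤ) - r) ∨ l = (q : ℤ) - r + 1 := by
  have h1 : ∀ s, s ≠ r → f' s = f s := by
    intro s hs
    have ha := h s (f s)
    have hb := h s (f' s)
    simp only [hs, false_and, or_false, lt_irrefl, iff_false, false_iff, not_lt] at ha hb
    omega
  have h2 : f r = q := by
    have ha := (h r q).mpr (by simp)
    have hb := h r (f r)
    simp only [lt_irrefl, true_and, false_or] at hb
    exact hb.mp (by omega)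
  have h3 : f' r = q + 1 := by
    have ha := (h r q).mpr (by simp)
    have hb := h r (q + 1)
    simp only [h2, true_and] at hb
    omega
  refine ⟨⟨r, by simp [h2]⟩, ?_, ?_⟩
  · rw [← h2, ← forall_lt_row_iff hf]
    intro s hs
    have := hf' hs.le
    rw [h1 s (by omega)] at this
    omega
  · intro l
    simp only [mem_beads]
    constructor
    · rintro ⟨s, rfl⟩
      by_cases hs : s = r
      · subst hs
        right
        omega
      · left
        rw [h1 s hs]
        refine ⟨⟨s, rfl⟩, fun hc => hs (row_eq_of_bead_eq hf ?_)⟩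
        rw [hc, h2]
    · rintro (⟨⟨s, rfl⟩, hs⟩ | rfl)
      · refine ⟨s, ?_⟩
        rw [h1 s]
        rintro rfl
        exact hs (by omega)
      · exact ⟨r, by omega⟩

/-! ### Addable and removable nodes -/

theorem isDiagram_rowsDiagram {f : Fin 3 → ℕ → ℕ} (hf : ∀ c, Antitone (f c)) :
    IsDiagram (rowsDiagram f) := by
  rintro c ⟨r, q⟩ ⟨r', q'⟩ hle h
  obtain ⟨h1, h2⟩ := Prod.mk_le_mk.mp hle
  simp only [rowsDiagram, Set.mem_ofPred_eq] at h ⊢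
  have := hf c h1
  omega

theorem isAddable_rowsDiagram_iff {f : Fin 3 → ℕ → ℕ} (hf : ∀ c, Antitone (f c)) (N : Node) :
    IsAddable (rowsDiagram f) N ↔
      f N.1 N.2.1 = N.2.2 ∧ (N.2.2 : ℤ) - N.2.1 + 1 ∉ beads (f N.1) := by
  obtain ⟨c, r, q⟩ := N
  simp only
  have key : f c r = q → ((∀ r' < r, f c r < f c r') ↔ (q : ℤ) - r + 1 ∉ beads (f c)) := by
    rintro rfl
    exact forall_lt_row_iff (hf c) r
  constructor
  · rintro ⟨h1, h2⟩
    have h1' : ¬ q < f c r := h1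
    have hmem : ∀ r' q', r' ≤ r → q' ≤ q → ((r', q') : ℕ × ℕ) ≠ (r, q) → q' < f c r' := by
      intro r' q' hr hq hne
      have := h2 c (show ((r', q') : ℕ × ℕ) ≤ (r, q) from Prod.mk_le_mk.mpr ⟨hr, hq⟩) (by simp)
      simp only [rowsDiagram, Set.mem_ofPred_eq, Set.mem_insert_iff, Prod.mk.injEq,
        true_and] at this
      rcases this with this | this
      · exact absurd (by rw [this.1, this.2]) hne
      · exact this
    have h3 : f c r = q := by
      rcases Nat.eq_zero_or_pos q with h0 | h0
      · omega
      · have := hmem r (q - 1) le_rfl (by omega) (by simp; omega)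
        omega
    refine ⟨h3, (key h3).mp fun r' hr' => ?_⟩
    have := hmem r' q hr'.le le_rfl (by simp; omega)
    omega
  · rintro ⟨h1, h2⟩
    have h3 := (key h1).mpr h2
    refine ⟨by simp [rowsDiagram, h1], ?_⟩
    rintro c' ⟨r₁, q₁⟩ ⟨r₂, q₂⟩ hle h
    obtain ⟨hr, hq⟩ := Prod.mk_le_mk.mp hle
    simp only [rowsDiagram, Set.mem_ofPred_eq, Set.mem_insert_iff, Prod.mk.injEq] at h ⊢
    rcases h with ⟨rfl, rfl, rfl⟩ | h
    · rcases Nat.lt_or_ge r₂ r₁ with h4 | h4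
      · right
        have := h3 r₂ h4
        omega
      · have : r₂ = r₁ := by omega
        subst this
        simp only [true_and]
        omega
    · right
      have := hf c' hr
      omega

theorem isRemovable_rowsDiagram_iff {f : Fin 3 → ℕ → ℕ} (hf : ∀ c, Antitone (f c)) (N : Node) :
    IsRemovable (rowsDiagram f) N ↔
      f N.1 N.2.1 = N.2.2 + 1 ∧ (N.2.2 : ℤ) - N.2.1 ∉ beads (f N.1) := by
  obtain ⟨c, r, q⟩ := N
  simp only
  have key : f c r = q + 1 → (f c (r + 1) < f c r ↔ (q : ℤ) - r ∉ beads (f c)) := by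
    intro h
    rw [succ_row_lt_iff (hf c) r, h]
    have : ((q + 1 : ℕ) : ℤ) - r - 1 = (q : ℤ) - r := by push_cast; ring
    rw [this]
  constructor
  · rintro ⟨h1, h2⟩
    have h1' : q < f c r := h1
    have hmem : ∀ r' q', r ≤ r' → q ≤ q' → ((r', q') : ℕ × ℕ) ≠ (r, q) → ¬ q' < f c r' := by
      intro r' q' hr hq hne hlt
      have := h2 c (show ((r, q) : ℕ × ℕ) ≤ (r', q') from Prod.mk_le_mk.mpr ⟨hr, hq⟩)
        ⟨hlt, by simpa using hne⟩
      simp at this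
    have h3 : f c r = q + 1 := by
      have := hmem r (q + 1) le_rfl (by omega) (by simp)
      omega
    refine ⟨h3, (key h3).mp ?_⟩
    have := hmem (r + 1) q (by omega) le_rfl (by simp)
    omega
  · rintro ⟨h1, h2⟩
    have h3 := (key h1).mpr h2
    refine ⟨by simp [rowsDiagram, h1], ?_⟩
    rintro c' ⟨r₁, q₁⟩ ⟨r₂, q₂⟩ hle ⟨h, hne⟩
    obtain ⟨hr, hq⟩ := Prod.mk_le_mk.mp hle
    refine ⟨isDiagram_rowsDiagram hf c' hle h, ?_⟩
    rintro heq
    simp only [Set.mem_singleton_iff, Prod.mk.injEq] at heq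
    obtain ⟨rfl, rfl, rfl⟩ := heq
    simp only [rowsDiagram, Set.mem_ofPred_eq] at h
    apply hne
    have h4 : r₁ = r₂ := by
      by_contra h5
      have := hf c' (show r₂ + 1 ≤ r₁ by omega)
      omega
    subst h4
    simp only [Set.mem_singleton_iff, Prod.mk.injEq, true_and]
    omega

open Classical in
/-- The addable nodes of the residue of `N` strictly after `N`, counted by their components. -/
theorem ncard_addable {f : Fin 3 → ℕ → ℕ} (hf : ∀ c, Antitone (f c)) (m : ℕ) (N : Node)
    (hN : (N.2.2 : ℤ) - N.2.1 ∉ beads (f N.1)) :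
    {M | IsAddable (rowsDiagram f) M ∧ StrictlyAfter M N ∧ residue m M = residue m N}.ncard =
      (Finset.univ.filter fun c => N.1 < c ∧ (N.2.2 : ℤ) - N.2.1 ∈ beads (f c) ∧
        (N.2.2 : ℤ) - N.2.1 + 1 ∉ beads (f c)).card := by
  rw [← Set.ncard_coe_finset, ← Set.InjOn.ncard_image (f := Prod.fst)]
  · congr 1
    ext c
    simp only [Set.mem_image, Finset.coe_filter, Finset.mem_univ, true_and, Set.mem_ofPred_eq]
    constructor
    · rintro ⟨⟨c', r, q⟩, ⟨h1, h2, h3⟩, rfl⟩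
      rw [isAddable_rowsDiagram_iff hf] at h1
      simp only [residue, StrictlyAfter] at h1 h2 h3 ⊢
      have h4 : (q : ℤ) - r = (N.2.2 : ℤ) - N.2.1 := by omega
      have h5 : (N.2.2 : ℤ) - N.2.1 ∈ beads (f c') := ⟨r, by simp only; omega⟩
      refine ⟨?_, h5, h4 ▸ h1.2⟩
      rcases h2 with h2 | ⟨h2, -⟩
      · exact h2
      · exact absurd (h2 ▸ h5) hN
    · rintro ⟨h1, ⟨r, hr⟩, h3⟩
      simp only at hr
      refine ⟨(c, r, f c r), ⟨?_, Or.inl h1, ?_⟩, rfl⟩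
      · rw [isAddable_rowsDiagram_iff hf]
        exact ⟨rfl, by simpa only [hr] using h3⟩
      · simp only [residue]
        omega
  · rintro ⟨c, r, q⟩ ⟨h1, -, h3⟩ ⟨c', r', q'⟩ ⟨h1', -, h3'⟩ hc
    obtain rfl : c = c' := hc
    rw [isAddable_rowsDiagram_iff hf] at h1 h1'
    simp only [residue] at h1 h1' h3 h3'
    obtain rfl : r = r' := row_eq_of_bead_eq (hf c) (by omega)
    simp only [Prod.mk.injEq, true_and]
    omega

open Classical in
/-- The removable nodes of the residue of `N` strictly after the removable node `N`, counted by
their components. -/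
theorem ncard_removable {f : Fin 3 → ℕ → ℕ} (hf : ∀ c, Antitone (f c)) (m : ℕ) (N : Node)
    (hN : f N.1 N.2.1 = N.2.2 + 1) :
    {M | IsRemovable (rowsDiagram f) M ∧ StrictlyAfter M N ∧ residue m M = residue m N}.ncard =
      (Finset.univ.filter fun c => N.1 < c ∧ (N.2.2 : ℤ) - N.2.1 ∉ beads (f c) ∧
        (N.2.2 : ℤ) - N.2.1 + 1 ∈ beads (f c)).card := by
  rw [← Set.ncard_coe_finset, ← Set.InjOn.ncard_image (f := Prod.fst)]
  · congr 1
    ext c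
    simp only [Set.mem_image, Finset.coe_filter, Finset.mem_univ, true_and, Set.mem_ofPred_eq]
    constructor
    · rintro ⟨⟨c', r, q⟩, ⟨h1, h2, h3⟩, rfl⟩
      rw [isRemovable_rowsDiagram_iff hf] at h1
      simp only [residue, StrictlyAfter] at h1 h2 h3 ⊢
      have h4 : (q : ℤ) - r = (N.2.2 : ℤ) - N.2.1 := by omega
      refine ⟨?_, h4 ▸ h1.2, ⟨r, by simp only; omega⟩⟩
      rcases h2 with h2 | ⟨h2, h5⟩
      · exact h2
      · have := row_eq_of_bead_eq (hf c') (r := r) (s := N.2.1) (by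
          have : f N.1 = f c' := by rw [h2]
          rw [this] at hN
          omega)
        omega
    · rintro ⟨h1, h3, ⟨r, hr⟩⟩
      simp only at hr
      -- A row of length zero always has a bead directly before its own.
      have h0 : f c r ≠ 0 := by
        intro h0
        have := hf c (show r ≤ r + 1 by omega)
        exact h3 ⟨r + 1, by push_cast; omega⟩
      refine ⟨(c, r, f c r - 1), ⟨?_, Or.inl h1, ?_⟩, rfl⟩
      · rw [isRemovable_rowsDiagram_iff hf]
        refine ⟨by simp only; omega, ?_⟩
        have : ((f c r - 1 : ℕ) : ℤ) - r = (N.2.2 : ℤ) - N.2.1 := by omega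
        simpa only [this] using h3
      · simp only [residue]
        omega
  · rintro ⟨c, r, q⟩ ⟨h1, -, h3⟩ ⟨c', r', q'⟩ ⟨h1', -, h3'⟩ hc
    obtain rfl : c = c' := hc
    rw [isRemovable_rowsDiagram_iff hf] at h1 h1'
    simp only [residue] at h1 h1' h3 h3'
    obtain rfl : r = r' := row_eq_of_bead_eq (hf c) (by omega)
    simp only [Prod.mk.injEq, true_and]
    omega

/-! ### The multipartition of a boundary datum -/

/-- Every finite set of positive numbers is the set of positive beads (shifted by its cardinality)
of a partition. -/
theorem exists_rows_of_finset (X : Finset ℕ) (hX : ∀ x ∈ X, 1 ≤ x) :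
    ∃ f : ℕ → ℕ, Antitone f ∧
      ∀ l : ℤ, l ∈ beads f ↔ l + X.card ≤ 0 ∨ ∃ x ∈ X, (x : ℤ) = l + X.card := by
  -- A new largest element becomes the first row, on top of the rows for the smaller elements.
  induction X using Finset.induction_on_max with
  | empty =>
    refine ⟨fun _ => 0, fun _ _ _ => le_rfl, fun l => ?_⟩
    simp only [mem_beads, Finset.card_empty, Finset.notMem_empty, false_and, exists_false, or_false]
    constructor
    · rintro ⟨r, rfl⟩
      simp
    · intro h
      exact ⟨l.natAbs, by push_cast at h ⊢; rw [abs_of_nonpos (by omega)]; omega⟩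
  | insert a X ha ih =>
    obtain ⟨f, hf, hb⟩ := ih fun x hx => hX x (by simp [hx])
    have ha1 := hX a (by simp)
    have hc : (insert a X).card = X.card + 1 :=
      Finset.card_insert_of_notMem fun h => lt_irrefl a (ha a h)
    have h0 : f 0 + X.card + 1 ≤ a := by
      rcases (hb _).mp ⟨0, rfl⟩ with h | ⟨x, hx, h⟩
      · simp only at h
        omega
      · have := ha x hx
        simp only at h
        omega
    obtain ⟨g, hg0, hgs⟩ : ∃ g : ℕ → ℕ, g 0 = a - (X.card + 1) ∧ ∀ r, g (r + 1) = f r :=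
      ⟨fun r => r.casesOn (a - (X.card + 1)) f, rfl, fun _ => rfl⟩
    refine ⟨g, antitone_nat_of_succ_le ?_, fun l => ?_⟩
    · rintro (_ | r)
      · rw [hgs, hg0]
        omega
      · rw [hgs, hgs]
        exact hf (Nat.le_succ r)
    · have key := hb (l + 1)
      rw [mem_beads] at key ⊢
      rw [hc]
      have e : l + ((X.card + 1 : ℕ) : ℤ) = l + 1 + X.card := by push_cast; ring
      rw [e]
      constructor
      · rintro ⟨_ | r, hr⟩
        · right
          exact ⟨a, by simp, by clear key hb ih; omega⟩
        · rw [hgs] at hr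
          push_cast at hr
          rcases key.mp ⟨r, by omega⟩ with h | ⟨x, hx, h⟩
          · exact Or.inl h
          · exact Or.inr ⟨x, by simp [hx], h⟩
      · intro h
        have : l + 1 = (a : ℤ) - X.card ∨ ∃ r : ℕ, (f r : ℤ) - r = l + 1 := by
          rcases h with h | ⟨x, hx, h⟩
          · exact Or.inr (key.mpr (Or.inl h))
          · rcases Finset.mem_insert.mp hx with hxa | hx
            · left
              omega
            · exact Or.inr (key.mpr (Or.inr ⟨x, hx, h⟩))
        clear key hb ih h
        rcases this with h | ⟨r, hr⟩
        · exact ⟨0, by omega⟩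
        · exact ⟨r + 1, by rw [hgs]; push_cast; omega⟩

theorem row_eq_zero_of_card_le {X : Finset ℕ} {f : ℕ → ℕ} (hf : Antitone f)
    (hb : ∀ l : ℤ, l ∈ beads f ↔ l + X.card ≤ 0 ∨ ∃ x ∈ X, (x : ℤ) = l + X.card) {r : ℕ}
    (hr : X.card ≤ r) : f r = 0 := by
  by_contra h
  have hpos : ∀ s ≤ X.card, 1 ≤ (f s : ℤ) - s + X.card := by
    intro s hs
    have := hf (hs.trans hr)
    omega
  have : (Finset.range (X.card + 1)).card ≤ X.card := by
    refine Finset.card_le_card_of_injOn (fun s => ((f s : ℤ) - s + X.card).toNat) ?_ ?_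
    · intro s hs
      have hs : s ≤ X.card := by simpa [Nat.lt_succ_iff] using hs
      have h1 := hpos s hs
      rcases (hb _).mp ⟨s, rfl⟩ with h2 | ⟨x, hx, h2⟩
      · simp only at h2
        omega
      · simp only at h2 ⊢
        rw [← h2]
        simpa using hx
    · intro s hs t ht hst
      have h1 := hpos s (by simpa [Nat.lt_succ_iff] using hs)
      have h2 := hpos t (by simpa [Nat.lt_succ_iff] using ht)
      simp only at hst
      exact row_eq_of_bead_eq hf (by omega)
  simp at this

theorem column_pos {D : List Symbol} {c : Fin 3} {x : ℕ} (hx : x ∈ column D c) :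
    1 ≤ x ∧ x ≤ D.length := by
  simpa using (Finset.mem_filter.mp hx).1

/-- The component `c` of the multipartition of `D` is the partition whose beads are the entries of
the column `c`. -/
theorem mem_shape_iff {D : List Symbol} {c : Fin 3} {f : ℕ → ℕ} (hf : Antitone f)
    (hb : ∀ l : ℤ, l ∈ beads f ↔
      l + (column D c).card ≤ 0 ∨ ∃ x ∈ column D c, (x : ℤ) = l + (column D c).card)
    (r q : ℕ) : (r, q) ∈ shape D c ↔ q < f r := by
  set X := column D c with hXdef
  have hzero : ∀ r, X.card ≤ r → f r = 0 := fun r hr => row_eq_zero_of_card_le hf hb hr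
  have hpos : ∀ s < X.card, 1 ≤ (f s : ℤ) - s + X.card := by
    intro s hs
    omega
  have hmem : ∀ s < X.card, ∃ x ∈ X, (x : ℤ) = (f s : ℤ) - s + X.card := by
    intro s hs
    rcases (hb _).mp ⟨s, rfl⟩ with h | h
    · have := hpos s hs
      simp only at h
      omega
    · exact h
  have hrow : ∀ x ∈ X, ∃ s < X.card, (x : ℤ) = (f s : ℤ) - s + X.card := by
    intro x hx
    obtain ⟨s, hs⟩ := (hb ((x : ℤ) - X.card)).mpr (Or.inr ⟨x, hx, by ring⟩)
    refine ⟨s, ?_, by simp only at hs; omega⟩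
    by_contra hc
    have := hzero s (by omega)
    have := (column_pos hx).1
    simp only at hs
    omega
  have hcard : ∀ x ∈ X, ∀ s < X.card, (x : ℤ) = (f s : ℤ) - s + X.card →
      (X.filter fun y => x < y).card = s := by
    intro x hx s hs hxs
    have himg : X.filter (fun y => x < y) =
        (Finset.range s).image fun t => ((f t : ℤ) - t + X.card).toNat := by
      ext y
      simp only [Finset.mem_filter, Finset.mem_image, Finset.mem_range]
      constructor
      · rintro ⟨hy, hxy⟩
        obtain ⟨t, ht, hyt⟩ := hrow y hy
        refine ⟨t, ?_, by omega⟩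
        by_contra hc
        have := hf (not_lt.mp hc)
        omega
      · rintro ⟨t, ht, rfl⟩
        obtain ⟨y, hy, hyt⟩ := hmem t (ht.trans hs)
        rw [← hyt, Int.toNat_natCast]
        have := hf ht.le
        exact ⟨hy, by omega⟩
    rw [himg, Finset.card_image_of_injOn, Finset.card_range]
    intro t ht t' ht' htt
    have h1 := hpos t (by have := Finset.mem_range.mp (Finset.mem_coe.mp ht); omega)
    have h2 := hpos t' (by have := Finset.mem_range.mp (Finset.mem_coe.mp ht'); omega)
    simp only at htt
    exact row_eq_of_bead_eq hf (by omega)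
  have hcard' : ∀ x ∈ X, (X.filter fun y => y ≤ x).card + (X.filter fun y => x < y).card =
      X.card := by
    intro x hx
    rw [← Finset.card_filter_add_card_filter_not (s := X) (fun y => y ≤ x)]
    simp only [not_le]
  have hshape : (r, q) ∈ shape D c ↔ (r < D.length + 1 ∧ q < D.length + 1) ∧
      ∃ x ∈ X, r ≤ (X.filter fun y => x < y).card ∧ q + (X.filter fun y => y ≤ x).card < x := by
    rw [← YoungDiagram.mem_cells]
    simp only [shape, Finset.mem_filter, Finset.mem_product, Finset.mem_range, hXdef]
  rw [hshape]
  have hle : X.card ≤ D.length := by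
    have := Finset.card_le_card (Finset.filter_subset
      (fun t => c ∈ (D.getD (t - 1) Symbol.circ).colors) (Finset.Icc 1 D.length))
    simpa [column, hXdef] using this
  constructor
  · rintro ⟨-, x, hx, h1, h2⟩
    obtain ⟨s, hs, hxs⟩ := hrow x hx
    have h3 := hcard x hx s hs hxs
    have h4 := hcard' x hx
    have := hf (show r ≤ s by omega)
    omega
  · intro h
    have hr : r < X.card := by
      by_contra hc
      have := hzero r (not_lt.mp hc)
      omega
    obtain ⟨x, hx, hxr⟩ := hmem r hr
    have h3 := hcard x hx r hr hxr
    have h4 := hcard' x hx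
    have h5 := column_pos hx
    exact ⟨⟨by omega, by omega⟩, x, hx, by omega, by omega⟩

/-- The positive beads of the component `c` of the multipartition of `D` are the entries of its
column `c`, up to a shift by the length of the column. -/
theorem beads_rowLen_shape (D : List Symbol) (c : Fin 3) (l : ℤ) :
    l ∈ beads (shape D c).rowLen ↔
      l + (column D c).card ≤ 0 ∨ ∃ x ∈ column D c, (x : ℤ) = l + (column D c).card := by
  obtain ⟨f, hf, hb⟩ := exists_rows_of_finset (column D c) fun x hx => (column_pos hx).1
  have : (shape D c).rowLen = f := by
    funext r
    refine eq_of_forall_lt_iff fun q => ?_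
    rw [← YoungDiagram.mem_iff_lt_rowLen, mem_shape_iff hf hb]
  rw [this, hb]

theorem antitone_rowLen (lam : YoungDiagram) : Antitone lam.rowLen :=
  lam.rowLen_anti

/-! ### The abacus of a standard tableau -/

theorem mem_nodes {lam : MultiPartition} {N : Node} : N ∈ nodes lam ↔ N.2 ∈ lam N.1 := by
  obtain ⟨c, p⟩ := N
  simp [nodes]

theorem mem_nodesWith {lam : MultiPartition} {T : Filling} {j : ℕ} {N : Node} :
    N ∈ nodesWith lam T j ↔ N.2 ∈ lam N.1 ∧ T N = j := by
  simp [nodesWith, mem_nodes]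

section Standard

variable {k : ℕ} {lam : MultiPartition} {T : Filling}

theorem lt_rowCount_iff (hT : IsStandard k lam T) (j : ℕ) (c : Fin 3) (r q : ℕ) :
    q < rowCount lam T j c r ↔ (r, q) ∈ lam c ∧ T (c, r, q) ≤ j := by
  have hlow : ∀ a b, a ≤ b → (r, b) ∈ lam c → T (c, r, b) ≤ j →
      (r, a) ∈ lam c ∧ T (c, r, a) ≤ j := by
    intro a b hab hb hj
    refine ⟨(lam c).up_left_mem le_rfl hab hb, ?_⟩
    rcases hab.eq_or_lt with rfl | h
    · exact hj
    · exact (hT.row_strict c r a b h hb).le.trans hj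
  have hmem : ∀ a, a ∈ (Finset.range ((lam c).rowLen r)).filter (fun q => T (c, r, q) ≤ j) ↔
      (r, a) ∈ lam c ∧ T (c, r, a) ≤ j := by
    intro a
    rw [Finset.mem_filter, Finset.mem_range, YoungDiagram.mem_iff_lt_rowLen]
  unfold rowCount
  constructor
  · intro h
    by_contra hq
    have hsub : (Finset.range ((lam c).rowLen r)).filter (fun q => T (c, r, q) ≤ j) ⊆
        Finset.range q := by
      intro a ha
      rw [Finset.mem_range]
      by_contra hqa
      have ha := (hmem a).mp ha
      exact hq (hlow q a (not_lt.mp hqa) ha.1 ha.2)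
    have := Finset.card_le_card hsub
    rw [Finset.card_range] at this
    omega
  · rintro ⟨h1, h2⟩
    have hsub : Finset.range (q + 1) ⊆
        (Finset.range ((lam c).rowLen r)).filter (fun q => T (c, r, q) ≤ j) := by
      intro a ha
      rw [Finset.mem_range] at ha
      exact (hmem a).mpr (hlow a q (by omega) h1 h2)
    have := Finset.card_le_card hsub
    rw [Finset.card_range] at this
    omega

theorem antitone_rowCount (hT : IsStandard k lam T) (j : ℕ) (c : Fin 3) :
    Antitone (rowCount lam T j c) := by
  intro r r' h
  refine le_of_forall_lt fun q hq => ?_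
  rw [lt_rowCount_iff hT] at hq ⊢
  refine ⟨(lam c).up_left_mem h le_rfl hq.1, ?_⟩
  rcases h.eq_or_lt with rfl | h
  · exact hq.2
  · exact (hT.col_strict c r r' q h hq.1).le.trans hq.2

theorem mem_towerColors {j : ℕ} {l : ℤ} {c : Fin 3} :
    c ∈ towerColors lam T j l ↔ l ∈ beads (rowCount lam T j c) := by
  simp [towerColors, mem_beads, eq_comm]

theorem eq_of_component_eq (hT : IsStandard k lam T) {M N : Node} (h0 : T M ≠ 0)
    (h : T M = T N) (hc : M.1 = N.1) : M = N := by
  by_contra hne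
  exact (hT.repeated M N h0 h hne).1 hc

/-- The rows before and after the step that adds the node `(c, r, q)`. -/
theorem rowCount_succ_of_node (hT : IsStandard k lam T) {j : ℕ} {c : Fin 3} {r q : ℕ}
    (hN : (c, r, q) ∈ nodesWith lam T (j + 1)) (r' q' : ℕ) :
    q' < rowCount lam T (j + 1) c r' ↔ q' < rowCount lam T j c r' ∨ (r' = r ∧ q' = q) := by
  obtain ⟨h1, h2⟩ := mem_nodesWith.mp hN
  rw [lt_rowCount_iff hT, lt_rowCount_iff hT]
  constructor
  · rintro ⟨h3, h4⟩
    rcases h4.lt_or_eq with h4 | h4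
    · exact Or.inl ⟨h3, by omega⟩
    · right
      have := eq_of_component_eq hT (M := (c, r', q')) (N := (c, r, q)) (by omega)
        (h4.trans h2.symm) rfl
      simpa using this
  · rintro (⟨h3, h4⟩ | ⟨rfl, rfl⟩)
    · exact ⟨h3, by omega⟩
    · exact ⟨h1, h2.le⟩

theorem rowCount_succ_of_forall_ne (hT : IsStandard k lam T) {j : ℕ} {c : Fin 3}
    (h : ∀ N ∈ nodesWith lam T (j + 1), N.1 ≠ c) :
    rowCount lam T (j + 1) c = rowCount lam T j c := by
  funext r
  refine eq_of_forall_lt_iff fun q => ?_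
  rw [lt_rowCount_iff hT, lt_rowCount_iff hT]
  constructor
  · rintro ⟨h1, h2⟩
    refine ⟨h1, ?_⟩
    by_contra h3
    exact h (c, r, q) (mem_nodesWith.mpr ⟨h1, by omega⟩) rfl
  · rintro ⟨h1, h2⟩
    exact ⟨h1, by omega⟩

/-- The components in which the `j`-th step adds a node. -/
def stepColors (lam : MultiPartition) (T : Filling) (j : ℕ) : Finset (Fin 3) :=
  (nodesWith lam T j).image Prod.fst

/-- All nodes of a step have the same content `p`, as equal entries have the same residue. -/
theorem exists_stepPosition (hT : IsStandard k lam T) (j : ℕ) :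
    ∃ p : ℤ, ∀ N ∈ nodesWith lam T (j + 1), (N.2.2 : ℤ) - N.2.1 = p := by
  rcases (nodesWith lam T (j + 1)).eq_empty_or_nonempty with h | ⟨M, hM⟩
  · exact ⟨0, by simp [h]⟩
  · refine ⟨(M.2.2 : ℤ) - M.2.1, fun N hN => ?_⟩
    by_cases hNM : N = M
    · rw [hNM]
    · have h1 := (mem_nodesWith.mp hN).2
      have h2 := (mem_nodesWith.mp hM).2
      have := (hT.repeated N M (by omega) (by omega) hNM).2
      simp only [residue] at this
      omega

variable {j : ℕ} {p : ℤ}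

theorem beads_of_mem_stepColors (hT : IsStandard k lam T)
    (hp : ∀ N ∈ nodesWith lam T (j + 1), (N.2.2 : ℤ) - N.2.1 = p) {c : Fin 3}
    (hc : c ∈ stepColors lam T (j + 1)) :
    p ∈ beads (rowCount lam T j c) ∧ p + 1 ∉ beads (rowCount lam T j c) ∧
    ∀ l, l ∈ beads (rowCount lam T (j + 1) c) ↔
      (l ∈ beads (rowCount lam T j c) ∧ l ≠ p) ∨ l = p + 1 := by
  obtain ⟨⟨c', r, q⟩, hN, rfl⟩ := Finset.mem_image.mp hc
  rw [← hp _ hN]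
  refine beads_of_add_node (antitone_rowCount hT _ _) (antitone_rowCount hT _ _)
    (rowCount_succ_of_node hT hN) ?_
  rw [lt_rowCount_iff hT]
  rintro ⟨-, h⟩
  have : T (c', r, q) = j + 1 := (mem_nodesWith.mp hN).2
  simp only at h
  omega

theorem stepColors_subset (hT : IsStandard k lam T)
    (hp : ∀ N ∈ nodesWith lam T (j + 1), (N.2.2 : ℤ) - N.2.1 = p) :
    stepColors lam T (j + 1) ⊆ towerColors lam T j p := fun _ hc =>
  mem_towerColors.mpr (beads_of_mem_stepColors hT hp hc).1

theorem disjoint_stepColors (hT : IsStandard k lam T)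
    (hp : ∀ N ∈ nodesWith lam T (j + 1), (N.2.2 : ℤ) - N.2.1 = p) :
    Disjoint (stepColors lam T (j + 1)) (towerColors lam T j (p + 1)) :=
  Finset.disjoint_left.mpr fun _ hc h =>
    (beads_of_mem_stepColors hT hp hc).2.1 (mem_towerColors.mp h)

theorem mem_towerColors_succ (hT : IsStandard k lam T)
    (hp : ∀ N ∈ nodesWith lam T (j + 1), (N.2.2 : ℤ) - N.2.1 = p) (c : Fin 3) (l : ℤ) :
    c ∈ towerColors lam T (j + 1) l ↔
      (c ∈ towerColors lam T j l ∧ ¬ (c ∈ stepColors lam T (j + 1) ∧ l = p)) ∨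
        (c ∈ stepColors lam T (j + 1) ∧ l = p + 1) := by
  rw [mem_towerColors, mem_towerColors]
  by_cases hc : c ∈ stepColors lam T (j + 1)
  · rw [(beads_of_mem_stepColors hT hp hc).2.2 l]
    simp [hc]
  · rw [rowCount_succ_of_forall_ne hT]
    · simp [hc]
    · rintro N hN rfl
      exact hc (Finset.mem_image_of_mem _ hN)

theorem towerColors_succ_left (hT : IsStandard k lam T)
    (hp : ∀ N ∈ nodesWith lam T (j + 1), (N.2.2 : ℤ) - N.2.1 = p) :
    towerColors lam T (j + 1) p = towerColors lam T j p \ stepColors lam T (j + 1) := by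
  ext c
  rw [mem_towerColors_succ hT hp, Finset.mem_sdiff]
  simp

theorem towerColors_succ_right (hT : IsStandard k lam T)
    (hp : ∀ N ∈ nodesWith lam T (j + 1), (N.2.2 : ℤ) - N.2.1 = p) :
    towerColors lam T (j + 1) (p + 1) =
      towerColors lam T j (p + 1) ∪ stepColors lam T (j + 1) := by
  ext c
  rw [mem_towerColors_succ hT hp, Finset.mem_union]
  simp

theorem towerColors_succ_of_ne (hT : IsStandard k lam T)
    (hp : ∀ N ∈ nodesWith lam T (j + 1), (N.2.2 : ℤ) - N.2.1 = p) {l : ℤ} (h1 : l ≠ p)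
    (h2 : l ≠ p + 1) : towerColors lam T (j + 1) l = towerColors lam T j l := by
  ext c
  rw [mem_towerColors_succ hT hp]
  simp [h1, h2]

/-! ### The degree of a step is local -/

theorem nodeDegree_eq (hT : IsStandard k lam T)
    (hp : ∀ N ∈ nodesWith lam T (j + 1), (N.2.2 : ℤ) - N.2.1 = p) {N : Node}
    (hN : N ∈ nodesWith lam T (j + 1)) :
    nodeDegree lam T N =
      (((towerColors lam T j p \ towerColors lam T j (p + 1)).filter (N.1 < ·)).card : ℤ) -
      (((towerColors lam T j (p + 1) \ towerColors lam T j p).filter (N.1 < ·)).card : ℤ) := by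
  classical
  -- The components up to that of `N` have already been changed by the step, the later ones not yet.
  set f : Fin 3 → ℕ → ℕ := fun c =>
    if c ≤ N.1 then rowCount lam T (j + 1) c else rowCount lam T j c with hfdef
  have hf : ∀ c, Antitone (f c) := by
    intro c
    simp only [hfdef]
    split_ifs <;> exact antitone_rowCount hT _ _
  have hTN := (mem_nodesWith.mp hN).2
  have hdiag : diagramAt lam T N = rowsDiagram f := by
    ext ⟨c, r, q⟩
    simp only [diagramAt, rowsDiagram, Set.mem_ofPred_eq, hTN, hfdef, mem_nodes]
    split_ifs with hc
    · rw [lt_rowCount_iff hT]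
      simp only [hc, and_true]
      refine and_congr_right fun _ => ?_
      omega
    · rw [lt_rowCount_iff hT]
      simp only [hc, and_false, or_false]
      refine and_congr_right fun _ => ?_
      omega
  have hfN : f N.1 = rowCount lam T (j + 1) N.1 := by simp [hfdef]
  have hb := beads_of_mem_stepColors hT hp (Finset.mem_image_of_mem Prod.fst hN)
  have hpN := hp N hN
  have hrow : f N.1 N.2.1 = N.2.2 + 1 := by
    rw [hfN]
    have h := rowCount_succ_of_node (c := N.1) (r := N.2.1) (q := N.2.2) hT hN N.2.1
    have h0 : ¬ N.2.2 < rowCount lam T j N.1 N.2.1 := by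
      rw [lt_rowCount_iff hT]
      rintro ⟨-, h1⟩
      have : T N ≤ j := h1
      omega
    have h1 := h N.2.2
    have h2 := h (N.2.2 + 1)
    simp only [and_self, or_true, iff_true, true_and] at h1 h2
    omega
  have hnot : (N.2.2 : ℤ) - N.2.1 ∉ beads (f N.1) := by
    rw [hfN, hpN, hb.2.2]
    simp
  unfold nodeDegree
  rw [hdiag, ncard_addable hf _ _ hnot, ncard_removable hf _ _ hrow, hpN]
  congr 3
  · ext c
    simp only [Finset.mem_filter, Finset.mem_univ, true_and, Finset.mem_sdiff, mem_towerColors]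
    constructor
    · rintro ⟨h1, h2⟩
      simp only [hfdef, not_le.mpr h1, if_false] at h2
      exact ⟨h2, h1⟩
    · rintro ⟨h2, h1⟩
      simp only [hfdef, not_le.mpr h1, if_false]
      exact ⟨h1, h2⟩
  · ext c
    simp only [Finset.mem_filter, Finset.mem_univ, true_and, Finset.mem_sdiff, mem_towerColors]
    constructor
    · rintro ⟨h1, h2⟩
      simp only [hfdef, not_le.mpr h1, if_false] at h2
      exact ⟨h2.symm, h1⟩
    · rintro ⟨h2, h1⟩
      simp only [hfdef, not_le.mpr h1, if_false]
      exact ⟨h1, h2.symm⟩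

theorem injOn_fst_nodesWith (hT : IsStandard k lam T) (j : ℕ) :
    Set.InjOn Prod.fst (nodesWith lam T (j + 1) : Set Node) := by
  intro M hM N hN h
  have h1 := (mem_nodesWith.mp (Finset.mem_coe.mp hM)).2
  have h2 := (mem_nodesWith.mp (Finset.mem_coe.mp hN)).2
  exact eq_of_component_eq hT (by omega) (by omega) h

/-- The degree of a step only depends on the colours of the two positions between which the
step moves beads. -/
theorem stepDegree_eq_localDeg (hT : IsStandard k lam T)
    (hp : ∀ N ∈ nodesWith lam T (j + 1), (N.2.2 : ℤ) - N.2.1 = p) :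
    stepDegree lam T (j + 1) = localDeg (towerColors lam T j p) (towerColors lam T j (p + 1))
      (stepColors lam T (j + 1)) := by
  unfold stepDegree localDeg stepColors
  rw [Finset.card_image_of_injOn (injOn_fst_nodesWith hT j),
    Finset.sum_image (injOn_fst_nodesWith hT j)]
  congr 1
  exact Finset.sum_congr rfl fun N hN => nodeDegree_eq hT hp hN

end Standard

theorem degBKW_eq_sum (k : ℕ) (lam : MultiPartition) (T : Filling) :
    degBKW k lam T = ∑ j ∈ Finset.range k, stepDegree lam T (j + 1) := by
  rw [degBKW, Finset.range_eq_Ico, Finset.sum_Ico_add' (fun j => stepDegree lam T j) 0 k 1]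
  rfl

/-! ### The growth algorithm -/

theorem strands_append (D E : List Symbol) : strands (D ++ E) = strands D ++ strands E :=
  List.filterMap_append

theorem strands_eq_nil {D : List Symbol} (h : ∀ s ∈ D, s.toStrand = none) : strands D = [] :=
  List.filterMap_eq_nil_iff.mpr h

theorem map_range_eq_append {α : Type} (g : ℤ → α) (a b c : ℕ) (s : ℤ) :
    (List.range (a + b + c)).map (fun t : ℕ => g (t + s)) =
      (List.range a).map (fun t : ℕ => g (t + s)) ++
      (List.range b).map (fun t : ℕ => g (t + (a + s))) ++
      (List.range c).map (fun t : ℕ => g (t + (a + b + s))) := by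
  rw [List.range_add, List.range_add]
  simp only [List.map_append, List.map_map]
  congr 1
  · congr 1
    refine List.map_congr_left fun t _ => ?_
    simp only [Function.comp_apply]
    congr 1
    push_cast
    ring
  · refine List.map_congr_left fun t _ => ?_
    simp only [Function.comp_apply]
    congr 1
    push_cast
    ring

theorem window_eq_map (lam : MultiPartition) :
    window lam = (List.range (maxRows lam + maxCols lam)).map
      fun t : ℕ => (t : ℤ) + (1 - (maxRows lam : ℤ)) := by
  simp only [window, List.bind_eq_flatMap, List.pure_def, ← List.map_eq_flatMap, List.map_map]
  refine List.map_congr_left fun t _ => ?_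
  simp only [Function.comp_apply]
  ring

theorem window_eq_append {lam : MultiPartition} {p : ℤ} (h1 : 1 - (maxRows lam : ℤ) ≤ p)
    (h2 : p + 1 ≤ maxCols lam) :
    window lam = ((window lam).filter fun l => l < p) ++ [p, p + 1] ++
      (window lam).filter fun l => p + 1 < l := by
  obtain ⟨a, ha⟩ : ∃ a : ℕ, (a : ℤ) = p - (1 - maxRows lam) := ⟨(p - (1 - maxRows lam)).toNat,
    by omega⟩
  obtain ⟨b, hb⟩ : ∃ b : ℕ, (b : ℤ) = maxCols lam - (p + 1) := ⟨(maxCols lam - (p + 1)).toNat,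
    by omega⟩
  have hw : window lam = (List.range a).map (fun t : ℕ => (t : ℤ) + (1 - (maxRows lam : ℤ))) ++
      [p, p + 1] ++ (List.range b).map (fun t : ℕ => (t : ℤ) + (p + 2)) := by
    have h := map_range_eq_append id a 2 b (1 - (maxRows lam : ℤ))
    have e : maxRows lam + maxCols lam = a + 2 + b := by omega
    simp only [id] at h
    rw [window_eq_map, e, h]
    have e2 : (a : ℤ) + (1 - (maxRows lam : ℤ)) = p := by omega
    have e3 : (a : ℤ) + (2 : ℕ) + (1 - (maxRows lam : ℤ)) = p + 2 := by push_cast; omega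
    rw [e2, e3]
    simp [List.range_succ, add_comm]
  have hlt : ((window lam).filter fun l => l < p) =
      (List.range a).map (fun t : ℕ => (t : ℤ) + (1 - (maxRows lam : ℤ))) := by
    rw [hw, List.filter_append, List.filter_append, List.filter_eq_self.mpr,
      List.filter_eq_nil_iff.mpr, List.filter_eq_nil_iff.mpr]
    · simp
    · intro l hl
      obtain ⟨t, -, rfl⟩ := List.mem_map.mp hl
      simp only [decide_eq_true_eq]
      omega
    · simp
    · intro l hl
      obtain ⟨t, ht, rfl⟩ := List.mem_map.mp hl
      have := List.mem_range.mp ht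
      simp only [decide_eq_true_eq]
      omega
  have hgt : ((window lam).filter fun l => p + 1 < l) =
      (List.range b).map (fun t : ℕ => (t : ℤ) + (p + 2)) := by
    rw [hw, List.filter_append, List.filter_append, List.filter_eq_nil_iff.mpr,
      List.filter_eq_nil_iff.mpr, List.filter_eq_self.mpr]
    · simp
    · intro l hl
      obtain ⟨t, -, rfl⟩ := List.mem_map.mp hl
      simp only [decide_eq_true_eq]
      omega
    · simp
    · intro l hl
      obtain ⟨t, ht, rfl⟩ := List.mem_map.mp hl
      have := List.mem_range.mp ht
      simp only [decide_eq_true_eq]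
      omega
  rw [hlt, hgt, ← hw]

section Standard

variable {k : ℕ} {lam : MultiPartition} {T : Filling}

theorem position_bounds {c : Fin 3} {r q : ℕ} (h : (r, q) ∈ lam c) :
    r < maxRows lam ∧ q < maxCols lam := by
  constructor
  · have h0 : (r, 0) ∈ lam c := (lam c).up_left_mem le_rfl (Nat.zero_le q) h
    exact (YoungDiagram.mem_iff_lt_colLen.mp h0).trans_le
      (Finset.le_sup (f := fun c => (lam c).colLen 0) (Finset.mem_univ c))
  · have h0 : (0, q) ∈ lam c := (lam c).up_left_mem (Nat.zero_le r) le_rfl h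
    exact (YoungDiagram.mem_iff_lt_rowLen.mp h0).trans_le
      (Finset.le_sup (f := fun c => (lam c).rowLen 0) (Finset.mem_univ c))

/-- The part of the web `g(T)` that is drawn for the step from the `j`-th to the `(j + 1)`-st
weight diagram. -/
noncomputable def growthStep (lam : MultiPartition) (T : Filling) (j : ℕ) : List (Slice Strand) :=
  (stepPositions lam T (j + 1)).flatMap fun p =>
    connect
      (towerStrands lam T j ((window lam).filter fun l => l < p))
      (towerStrands lam T j ((window lam).filter fun l => p + 1 < l))
      (rungStrand lam T (j + 1))
      (towerStrands lam T j [p, p + 1])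
      (towerStrands lam T (j + 1) [p, p + 1])

theorem growthStep_spec (hT : IsStandard k lam T) (j : ℕ) :
    (∀ s ∈ growthStep lam T j, (s.piece.map Prod.fst).IsWeb) ∧
    (∀ s ∈ growthStep lam T j, (s.piece.map Prod.snd).IsFlow) ∧
    Connects (towerStrands lam T j (window lam)) (growthStep lam T j)
      (towerStrands lam T (j + 1) (window lam)) ∧
    weight (growthStep lam T j) = -stepDegree lam T (j + 1) := by
  obtain ⟨p, hp⟩ := exists_stepPosition hT j
  rw [stepDegree_eq_localDeg hT hp]
  rcases (nodesWith lam T (j + 1)).eq_empty_or_nonempty with h | hne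
  · have hpos : growthStep lam T j = [] := by simp [growthStep, stepPositions, h]
    have hS : stepColors lam T (j + 1) = ∅ := by simp [stepColors, h]
    have htow : tower lam T (j + 1) = tower lam T j := by
      funext l
      unfold tower
      congr 1
      ext c
      rw [mem_towerColors_succ hT hp, hS]
      simp
    rw [hpos, hS]
    simp [Connects, weight, localDeg, towerStrands, htow, dividedShift]
  · have hpos : stepPositions lam T (j + 1) = [p] := by
      have : (nodesWith lam T (j + 1)).image (residue 0) = {p} := by
        rw [Finset.eq_singleton_iff_unique_mem]
        constructor
        · obtain ⟨N, hN⟩ := hne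
          exact Finset.mem_image.mpr ⟨N, hN, by simp [residue, hp N hN]⟩
        · intro l hl
          obtain ⟨N, hN, rfl⟩ := Finset.mem_image.mp hl
          simp [residue, hp N hN]
      rw [stepPositions, this, Finset.sort_singleton]
    have hsteps := localPicture_spec (towerColors lam T j p) (towerColors lam T j (p + 1))
      (stepColors lam T (j + 1)) (hne.image _) (stepColors_subset hT hp)
      (disjoint_stepColors hT hp)
    have hg : growthStep lam T j = (localPicture (towerColors lam T j p)
        (towerColors lam T j (p + 1)) (stepColors lam T (j + 1))).map
        (Slice.frame (towerStrands lam T j ((window lam).filter fun l => l < p))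
          (towerStrands lam T j ((window lam).filter fun l => p + 1 < l))) := by
      rw [growthStep, hpos, List.flatMap_singleton, connect_eq_frame, localPicture,
        ← towerColors_succ_left hT hp, ← towerColors_succ_right hT hp]
      rfl
    have hw : ∀ i, towerStrands lam T i (window lam) =
        towerStrands lam T i ((window lam).filter fun l => l < p) ++
        strands [Symbol.ofColors (towerColors lam T i p),
          Symbol.ofColors (towerColors lam T i (p + 1))] ++
        towerStrands lam T i ((window lam).filter fun l => p + 1 < l) := by
      intro i
      obtain ⟨⟨c, r, q⟩, hN⟩ := hne
      have hpN := hp _ hN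
      have hb := position_bounds (mem_nodesWith.mp hN).1
      simp only at hpN
      conv_lhs => rw [window_eq_append (lam := lam) (p := p) (by omega) (by omega)]
      simp only [towerStrands, List.map_append, strands_append]
      rfl
    have hsame : ∀ l : List ℤ, (∀ x ∈ l, x ≠ p ∧ x ≠ p + 1) →
        towerStrands lam T (j + 1) l = towerStrands lam T j l := by
      intro l hl
      unfold towerStrands
      congr 1
      refine List.map_congr_left fun x hx => ?_
      unfold tower
      rw [towerColors_succ_of_ne hT hp (hl x hx).1 (hl x hx).2]
    obtain ⟨h1, h2, h3, h4⟩ := hsteps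
    refine ⟨?_, ?_, ?_, ?_⟩
    · intro s hs
      rw [hg] at hs
      obtain ⟨s', hs', rfl⟩ := List.mem_map.mp hs
      exact h1 s' hs'
    · intro s hs
      rw [hg] at hs
      obtain ⟨s', hs', rfl⟩ := List.mem_map.mp hs
      exact h2 s' hs'
    · rw [hw, hw, hsame, hsame, hg, towerColors_succ_left hT hp, towerColors_succ_right hT hp]
      · exact connects_frame _ _ _ _ _ h3
      · intro x hx
        have := (List.mem_filter.mp hx).2
        simp only [decide_eq_true_eq] at this
        omega
      · intro x hx
        have := (List.mem_filter.mp hx).2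
        simp only [decide_eq_true_eq] at this
        omega
    · rw [hg, weight_map_frame, h4]

theorem growth_eq_flatMap (k : ℕ) (lam : MultiPartition) (T : Filling) :
    growth k lam T = (List.range k).flatMap (growthStep lam T) := rfl

theorem growth_spec (hT : IsStandard k lam T) (j : ℕ) :
    (∀ s ∈ growth j lam T, (s.piece.map Prod.fst).IsWeb) ∧
    (∀ s ∈ growth j lam T, (s.piece.map Prod.snd).IsFlow) ∧
    Connects (towerStrands lam T 0 (window lam)) (growth j lam T)
      (towerStrands lam T j (window lam)) ∧
    weight (growth j lam T) = -∑ i ∈ Finset.range j, stepDegree lam T (i + 1) := by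
  induction j with
  | zero => simp [growth, Connects, weight]
  | succ j ih =>
    obtain ⟨h1, h2, h3, h4⟩ := ih
    obtain ⟨g1, g2, g3, g4⟩ := growthStep_spec hT j
    have hg : growth (j + 1) lam T = growth j lam T ++ growthStep lam T j := by
      rw [growth_eq_flatMap, growth_eq_flatMap, List.range_succ, List.flatMap_append,
        List.flatMap_singleton]
    rw [hg]
    refine ⟨?_, ?_, ?_, ?_⟩
    · intro s hs
      exact (List.mem_append.mp hs).elim (h1 s) (g1 s)
    · intro s hs
      exact (List.mem_append.mp hs).elim (h2 s) (g2 s)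
    · exact (connects_append _ _ _ _).mpr ⟨_, h3, g3⟩
    · rw [weight_append, h4, g4, Finset.sum_range_succ]
      ring

theorem towerStrands_zero (hT : IsStandard k lam T) (l : List ℤ) :
    towerStrands lam T 0 l = [] := by
  refine strands_eq_nil fun s hs => ?_
  obtain ⟨x, -, rfl⟩ := List.mem_map.mp hs
  have hrow : ∀ c r, rowCount lam T 0 c r = 0 := by
    intro c r
    by_contra h
    obtain ⟨h1, h2⟩ := (lt_rowCount_iff hT 0 c r 0).mp (Nat.pos_of_ne_zero h)
    exact (hT.filled (c, r, 0)).mpr h1 (Nat.le_zero.mp h2)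
  have hmem : ∀ c, c ∈ towerColors lam T 0 x ↔ x ≤ 0 := by
    intro c
    rw [mem_towerColors, mem_beads]
    simp only [hrow]
    constructor
    · rintro ⟨r, rfl⟩
      simp
    · intro h
      exact ⟨x.natAbs, by rw [Int.natCast_natAbs, abs_of_nonpos h]; simp⟩
  unfold tower
  by_cases hx : x ≤ 0
  · have : towerColors lam T 0 x = Finset.univ := by
      ext c
      simp [hmem, hx]
    rw [this]
    rfl
  · have : towerColors lam T 0 x = ∅ := by
      ext c
      simp [hmem, hx]
    rw [this]
    decide

theorem rowCount_eq_rowLen (hT : IsStandard k lam T) (c : Fin 3) :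
    rowCount lam T k c = (lam c).rowLen := by
  funext r
  refine eq_of_forall_lt_iff fun q => ?_
  rw [lt_rowCount_iff hT, YoungDiagram.mem_iff_lt_rowLen]
  simp [hT.le]

end Standard

/-! ### The boundary of the tower -/

theorem mem_column {D : List Symbol} {c : Fin 3} {x : ℕ} :
    x ∈ column D c ↔ (1 ≤ x ∧ x ≤ D.length) ∧ c ∈ (D.getD (x - 1) Symbol.circ).colors := by
  rw [column, Finset.mem_filter, Finset.mem_Icc]

section Boundary

variable {ℓ : ℕ} {D : List Symbol}

theorem mem_beads_shape (hD : ∀ c : Fin 3, (column D c).card = ℓ) (c : Fin 3) (l : ℤ) :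
    l ∈ beads (shape D c).rowLen ↔ l + ℓ ≤ 0 ∨ ∃ x ∈ column D c, (x : ℤ) = l + ℓ := by
  rw [beads_rowLen_shape, hD]

theorem mem_beads_shape_of_lt (hD : ∀ c : Fin 3, (column D c).card = ℓ) {t : ℕ}
    (ht : t < D.length) (c : Fin 3) :
    (t : ℤ) + 1 - ℓ ∈ beads (shape D c).rowLen ↔ c ∈ (D.getD t Symbol.circ).colors := by
  rw [mem_beads_shape hD]
  constructor
  · rintro (h | ⟨x, hx, h⟩)
    · omega
    · have : x = t + 1 := by omega
      subst this
      exact (mem_column.mp hx).2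
  · intro h
    exact Or.inr ⟨t + 1, mem_column.mpr ⟨⟨by omega, by omega⟩, h⟩, by push_cast; ring⟩

theorem maxRows_shape_le (hD : ∀ c : Fin 3, (column D c).card = ℓ) : maxRows (shape D) ≤ ℓ := by
  refine Finset.sup_le fun c _ => ?_
  by_contra h
  have h0 := YoungDiagram.mem_iff_lt_rowLen.mp
    (YoungDiagram.mem_iff_lt_colLen.mpr (not_le.mp h))
  have := row_eq_zero_of_card_le (antitone_rowLen _) (beads_rowLen_shape D c)
    (le_of_eq (hD c))
  omega

theorem add_maxCols_shape_le (hD : ∀ c : Fin 3, (column D c).card = ℓ) :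
    ℓ + maxCols (shape D) ≤ D.length := by
  have hℓ : ℓ ≤ D.length := by
    have := Finset.card_le_card (Finset.filter_subset
      (fun t => (0 : Fin 3) ∈ (D.getD (t - 1) Symbol.circ).colors) (Finset.Icc 1 D.length))
    rw [← hD 0]
    simpa [column] using this
  have : maxCols (shape D) ≤ D.length - ℓ := by
    refine Finset.sup_le fun c _ => ?_
    rcases (mem_beads_shape hD c _).mp ⟨0, rfl⟩ with h | ⟨x, hx, h⟩
    · simp only at h
      omega
    · have := column_pos hx
      simp only at h
      omega
  omega

/-- The row `D` agrees with the part of the last weight diagram inside the window. -/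
theorem strands_eq_window (hD : ∀ c : Fin 3, (column D c).card = ℓ) (C : ℤ → Finset (Fin 3))
    (hC : ∀ l c, c ∈ C l ↔ l ∈ beads (shape D c).rowLen) :
    strands D = strands ((window (shape D)).map fun l => Symbol.ofColors (C l)) := by
  have hr := maxRows_shape_le hD
  have hc := add_maxCols_shape_le hD
  have hsym : ∀ t < D.length, D.getD t Symbol.circ = Symbol.ofColors (C ((t : ℤ) + (1 - ℓ))) := by
    intro t ht
    rw [← ofColors_colors (D.getD t Symbol.circ)]
    congr 1
    ext c
    rw [hC, ← mem_beads_shape_of_lt hD ht]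
    congr! 1
    ring
  have hDmap : D = (List.range D.length).map
      (fun t : ℕ => Symbol.ofColors (C ((t : ℤ) + (1 - ℓ)))) := by
    refine List.ext_getElem (by simp) fun t h1 h2 => ?_
    rw [List.getElem_map, List.getElem_range, ← hsym t h1, List.getD_eq_getElem _ _ h1]
  have e : D.length = (ℓ - maxRows (shape D)) + (maxRows (shape D) + maxCols (shape D)) +
      (D.length - (ℓ + maxCols (shape D))) := by omega
  conv_lhs => rw [hDmap, e]
  rw [map_range_eq_append (fun l => Symbol.ofColors (C l)), strands_append,
    strands_append]
  -- To the left of the window all rows are empty and the entries are `×`.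
  have hleft : strands ((List.range (ℓ - maxRows (shape D))).map
      (fun t : ℕ => Symbol.ofColors (C ((t : ℤ) + (1 - ℓ))))) = [] := by
    refine strands_eq_nil fun s hs => ?_
    obtain ⟨t, ht, rfl⟩ := List.mem_map.mp hs
    have ht := List.mem_range.mp ht
    have : C ((t : ℤ) + (1 - ℓ)) = Finset.univ := by
      ext c
      simp only [Finset.mem_univ, iff_true]
      rw [hC]
      refine ⟨ℓ - 1 - t, ?_⟩
      have h0 : (shape D c).rowLen (ℓ - 1 - t) = 0 := by
        by_contra h
        have h1 := YoungDiagram.mem_iff_lt_rowLen.mpr (Nat.pos_of_ne_zero h)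
        have := (position_bounds (lam := shape D) h1).1
        omega
      simp only [h0]
      omega
    rw [this]
    rfl
  -- To the right of the window there are no beads and the entries are `∘`.
  have hright : strands ((List.range (D.length - (ℓ + maxCols (shape D)))).map
      (fun t : ℕ => Symbol.ofColors (C ((t : ℤ) + (((ℓ - maxRows (shape D) : ℕ) : ℤ) +
        ((maxRows (shape D) + maxCols (shape D) : ℕ) : ℤ) + (1 - ℓ)))))) = [] := by
    refine strands_eq_nil fun s hs => ?_
    obtain ⟨t, ht, rfl⟩ := List.mem_map.mp hs
    have : C ((t : ℤ) + (((ℓ - maxRows (shape D) : ℕ) : ℤ) +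
        ((maxRows (shape D) + maxCols (shape D) : ℕ) : ℤ) + (1 - ℓ))) = ∅ := by
      ext c
      simp only [Finset.notMem_empty, iff_false]
      rw [hC]
      rintro ⟨r, hr'⟩
      have h1 := antitone_rowLen (shape D c) (Nat.zero_le r)
      have h2 : (shape D c).rowLen 0 ≤ maxCols (shape D) :=
        Finset.le_sup (f := fun c => (shape D c).rowLen 0) (Finset.mem_univ c)
      simp only at hr'
      push_cast at hr'
      omega
    rw [this]
    decide
  rw [hleft, hright, List.nil_append, List.append_nil, window_eq_map, List.map_map]
  congr 1
  refine List.map_congr_left fun t _ => ?_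
  simp only [Function.comp_apply]
  congr 2
  omega

theorem growth_mem_flowWebs (hD : ∀ c : Fin 3, (column D c).card = ℓ) {k : ℕ} {T : Filling}
    (hT : IsStandard k (shape D) T) : growth k (shape D) T ∈ flowWebs D := by
  obtain ⟨h1, h2, h3, -⟩ := growth_spec hT k
  refine ⟨h1, h2, ?_⟩
  rw [towerStrands_zero hT] at h3
  rw [strands_eq_window hD (towerColors (shape D) T k)]
  · exact h3
  · intro l c
    rw [mem_towerColors, rowCount_eq_rowLen hT]

theorem degWt_growth {lam : MultiPartition} {k : ℕ} {T : Filling} (hT : IsStandard k lam T) :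
    degWt (growth k lam T) = degBKW k lam T := by
  rw [degWt, (growth_spec hT k).2.2.2, degBKW_eq_sum, neg_neg]

end Boundary

/-! ### Local pictures with flow in a ladder -/

/-- Slices whose underlying web has only vertical edges outside of a middle part are determined by
this middle part. -/
theorem exists_unframe (L R x : List Strand) (u : List (Slice Strand)) (row : List Strand)
    (u₀ : List (Slice Orientation))
    (h : u.map (Slice.map Prod.fst) = u₀.map (Slice.frame (L.map Prod.fst) (R.map Prod.fst)))
    (hc : Connects (L ++ x ++ R) u row) :
    ∃ u' y, u = u'.map (Slice.frame L R) ∧ u'.map (Slice.map Prod.fst) = u₀ ∧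
      Connects x u' y ∧ row = L ++ y ++ R := by
  induction u generalizing x u₀ with
  | nil =>
    have h0 : u₀ = [] := List.map_eq_nil_iff.mp h.symm
    refine ⟨[], x, rfl, by simp [h0], rfl, hc.symm⟩
  | cons s u ih =>
    obtain _ | ⟨s₀, u₀⟩ := u₀
    · simp at h
    simp only [List.map_cons, List.cons.injEq] at h
    obtain ⟨hs, hu⟩ := h
    obtain ⟨hb, hc⟩ := hc
    obtain ⟨sl, sp, sr⟩ := s
    obtain ⟨l₀, p₀, r₀⟩ := s₀
    simp only [Slice.map, Slice.frame, Slice.mk.injEq] at hs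
    obtain ⟨h1, h2, h3⟩ := hs
    obtain ⟨l₁, l₂, rfl, hl₁, hl₂⟩ := List.map_eq_append_iff.mp h1
    obtain ⟨r₁, r₂, rfl, hr₁, hr₂⟩ := List.map_eq_append_iff.mp h3
    simp only [Slice.bottom] at hb
    have e1 : l₁.length = L.length := by simpa using congrArg List.length hl₁
    have e2 : r₂.length = R.length := by simpa using congrArg List.length hr₂
    have hb' : l₁ ++ ((l₂ ++ sp.bottom ++ r₁) ++ r₂) = L ++ (x ++ R) := by
      simpa [List.append_assoc] using hb
    obtain ⟨rfl, hb2⟩ := List.append_inj hb' e1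
    obtain ⟨rfl, rfl⟩ := List.append_inj' hb2 e2
    have hc' : Connects (l₁ ++ (l₂ ++ sp.top ++ r₁) ++ r₂) u row := by
      simpa [Slice.top, List.append_assoc] using hc
    obtain ⟨u', y, rfl, hu', hy, hrow⟩ := ih _ _ hu hc'
    exact ⟨⟨l₂, sp, r₁⟩ :: u', y, rfl, by simp [Slice.map, hl₂, h2, hr₁, hu'], ⟨rfl, hy⟩, hrow⟩

/-- The colours at a position of weight `w`, where `o` is the strand drawn there if `w` is `1`
or `2`. -/
def colorOf (w : ℕ) (o : Option Strand) : Finset (Fin 3) :=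
  if w = 0 then ∅ else if w = 3 then Finset.univ else (o.map strandColors).getD ∅

/-- The orientations of the edges at two neighbouring positions of weights `a` and `b`. -/
def pairOrientations (a b : ℕ) : List Orientation := [a, b].filterMap orientationOfWeight

/-- The number of edges drawn at a position of weight `a`. -/
def edgeCount (a : ℕ) : ℕ := ([a].filterMap orientationOfWeight).length

/-- The step from the strands `x` at two neighbouring positions of weights `a` and `b` to the
strands `y` at the weights `a - j` and `b + j` moves a set of colours to the right, and `v` is minus
the degree of this step. -/
def IsColorStep (a b j : ℕ) (x y : List Strand) (v : ℤ) : Prop :=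
  colorOf (a - j) y[0]? ⊆ colorOf a x[0]? ∧
  Disjoint (colorOf a x[0]? \ colorOf (a - j) y[0]?) (colorOf b x[edgeCount a]?) ∧
  colorOf (b + j) y[edgeCount (a - j)]? =
    colorOf b x[edgeCount a]? ∪ (colorOf a x[0]? \ colorOf (a - j) y[0]?) ∧
  v = -localDeg (colorOf a x[0]?) (colorOf b x[edgeCount a]?)
    (colorOf a x[0]? \ colorOf (a - j) y[0]?)

instance (a b j : ℕ) (x y : List Strand) (v : ℤ) : Decidable (IsColorStep a b j x y v) := by
  unfold IsColorStep; infer_instance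

theorem map_fst_eq_singleton {x : List Strand} {o : Orientation} (h : x.map Prod.fst = [o]) :
    ∃ s, x = [(o, s)] := by
  obtain ⟨⟨o', s⟩, rfl, rfl⟩ := List.map_eq_singleton_iff.mp h
  exact ⟨s, rfl⟩

theorem piece_eq_cup {u : List (Slice Strand)} {a b : Orientation}
    (h : u.map (Slice.map Prod.fst) = [⟨[], .cup a b, []⟩]) :
    ∃ s t, u = [⟨[], .cup (a, s) (b, t), []⟩] := by
  obtain ⟨⟨l, p, r⟩, rfl, h'⟩ := List.map_eq_singleton_iff.mp h
  cases p <;> simp only [Slice.map, Piece.map, Slice.mk.injEq, List.map_eq_nil_iff, reduceCtorEq,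
    false_and, and_false, Piece.cup.injEq] at h'
  obtain ⟨rfl, ⟨rfl, rfl⟩, rfl⟩ := h'
  exact ⟨_, _, rfl⟩

theorem piece_eq_cap {u : List (Slice Strand)} {a b : Orientation}
    (h : u.map (Slice.map Prod.fst) = [⟨[], .cap a b, []⟩]) :
    ∃ s t, u = [⟨[], .cap (a, s) (b, t), []⟩] := by
  obtain ⟨⟨l, p, r⟩, rfl, h'⟩ := List.map_eq_singleton_iff.mp h
  cases p <;> simp only [Slice.map, Piece.map, Slice.mk.injEq, List.map_eq_nil_iff, reduceCtorEq,
    false_and, and_false, Piece.cap.injEq] at h'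
  obtain ⟨rfl, ⟨rfl, rfl⟩, rfl⟩ := h'
  exact ⟨_, _, rfl⟩

theorem piece_eq_split {u : List (Slice Strand)} {a b c : Orientation}
    (h : u.map (Slice.map Prod.fst) = [⟨[], .split a b c, []⟩]) :
    ∃ s t v, u = [⟨[], .split (a, s) (b, t) (c, v), []⟩] := by
  obtain ⟨⟨l, p, r⟩, rfl, h'⟩ := List.map_eq_singleton_iff.mp h
  cases p <;> simp only [Slice.map, Piece.map, Slice.mk.injEq, List.map_eq_nil_iff, reduceCtorEq,
    false_and, and_false, Piece.split.injEq] at h'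
  obtain ⟨rfl, ⟨rfl, rfl, rfl⟩, rfl⟩ := h'
  exact ⟨_, _, _, rfl⟩

theorem piece_eq_merge {u : List (Slice Strand)} {a b c : Orientation}
    (h : u.map (Slice.map Prod.fst) = [⟨[], .merge a b c, []⟩]) :
    ∃ s t v, u = [⟨[], .merge (a, s) (b, t) (c, v), []⟩] := by
  obtain ⟨⟨l, p, r⟩, rfl, h'⟩ := List.map_eq_singleton_iff.mp h
  cases p <;> simp only [Slice.map, Piece.map, Slice.mk.injEq, List.map_eq_nil_iff, reduceCtorEq,
    false_and, and_false, Piece.merge.injEq] at h'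
  obtain ⟨rfl, ⟨rfl, rfl, rfl⟩, rfl⟩ := h'
  exact ⟨_, _, _, rfl⟩

theorem pieces_eq_H {u : List (Slice Strand)} {a b c d r : Orientation} {x y : List Strand}
    (h : u.map (Slice.map Prod.fst) = [⟨[], .split a c r, [b]⟩, ⟨[c], .merge r b d, []⟩])
    (hc : Connects x u y) :
    ∃ sa sb sc sd sr, u = [⟨[], .split (a, sa) (c, sc) (r, sr), [(b, sb)]⟩,
      ⟨[(c, sc)], .merge (r, sr) (b, sb) (d, sd), []⟩] := by
  obtain ⟨⟨l, p, q⟩, v, rfl, h1, h2⟩ := List.map_eq_cons_iff.mp h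
  obtain ⟨⟨l', p', q'⟩, rfl, h2'⟩ := List.map_eq_singleton_iff.mp h2
  cases p <;> simp only [Slice.map, Piece.map, Slice.mk.injEq, List.map_eq_nil_iff, reduceCtorEq,
    false_and, and_false, Piece.split.injEq] at h1
  cases p' <;> simp only [Slice.map, Piece.map, Slice.mk.injEq, List.map_eq_nil_iff, reduceCtorEq,
    false_and, and_false, Piece.merge.injEq] at h2'
  obtain ⟨rfl, ⟨rfl, rfl, rfl⟩, hq⟩ := h1
  obtain ⟨hl, ⟨h3, rfl, rfl⟩, rfl⟩ := h2'
  obtain ⟨sq, rfl⟩ := map_fst_eq_singleton hq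
  obtain ⟨sl, rfl⟩ := map_fst_eq_singleton hl
  obtain ⟨-, hb, -⟩ := hc
  simp only [Slice.bottom, Slice.top, Piece.bottom, Piece.top, List.nil_append, List.cons_append,
    List.append_nil, List.cons.injEq, and_true] at hb
  obtain ⟨hb1, hb2, hb3⟩ := hb
  rw [← hb1, ← hb2, hb3]
  exact ⟨_, _, _, _, _, rfl⟩

/-- On the local picture of a divided power, the flow condition at the arcs and vertices says that
colours are neither created nor lost. This is a finite check for each of the fourteen possible
triples `(a, b, j)`. -/
theorem isColorStep_of_flow {a b j : ℕ} (hj : 1 ≤ j) (hja : j ≤ a) (ha : a ≤ 3) (hb : b + j ≤ 3)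
    {x y : List Strand} {u : List (Slice Strand)} (hc : Connects x u y)
    (hx : x.map Prod.fst = pairOrientations a b)
    (hu : u.map (Slice.map Prod.fst) =
      connect [] [] .up (pairOrientations a b) (pairOrientations (a - j) (b + j)))
    (hf : ∀ s ∈ u, (s.piece.map Prod.snd).IsFlow) :
    y.map Prod.fst = pairOrientations (a - j) (b + j) ∧ IsColorStep a b j x y (weight u) := by
  have hb2 : b ≤ 2 := by omega
  have hj3 : j ≤ 3 := by omega
  interval_cases a <;> interval_cases b <;> interval_cases j <;> first | omega | skip
  all_goals
    simp only [pairOrientations, orientationOfWeight, List.filterMap_cons, List.filterMap_nil,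
      connect, Nat.reduceSub, Nat.reduceAdd, List.nil_append] at hx hu ⊢
  all_goals first
    | obtain ⟨s, t, rfl⟩ := piece_eq_cup hu
      obtain ⟨rfl, rfl⟩ := hc
      have hs := hf _ (List.mem_singleton_self _)
      refine ⟨rfl, ?_⟩
      revert hs
      clear * -
      revert s t
      decide
    | obtain ⟨s, t, rfl⟩ := piece_eq_cap hu
      obtain ⟨rfl, rfl⟩ := hc
      have hs := hf _ (List.mem_singleton_self _)
      refine ⟨rfl, ?_⟩
      revert hs
      clear * -
      revert s t
      decide
    | obtain ⟨s, t, v, rfl⟩ := piece_eq_split hu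
      obtain ⟨rfl, rfl⟩ := hc
      have hs := hf _ (List.mem_singleton_self _)
      refine ⟨rfl, ?_⟩
      revert hs
      clear * -
      revert s t v
      decide
    | obtain ⟨s, t, v, rfl⟩ := piece_eq_merge hu
      obtain ⟨rfl, rfl⟩ := hc
      have hs := hf _ (List.mem_singleton_self _)
      refine ⟨rfl, ?_⟩
      revert hs
      clear * -
      revert s t v
      decide
    | obtain ⟨sa, sb, sc, sd, sr, rfl⟩ := pieces_eq_H hu hc
      obtain ⟨rfl, -, rfl⟩ := hc
      have hs := hf _ List.mem_cons_self
      have ht := hf _ (List.mem_cons_of_mem _ (List.mem_singleton_self _))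
      refine ⟨rfl, ?_⟩
      revert hs ht
      clear * -
      revert sa sb sc sd sr
      decide +kernel
    | obtain rfl := List.map_eq_nil_iff.mp hu
      obtain rfl := hc
      refine ⟨hx, ?_⟩
      obtain ⟨s, rfl⟩ := map_fst_eq_singleton hx
      clear * -
      revert s
      decide
    | obtain rfl := List.map_eq_nil_iff.mp hu
      obtain rfl := hc
      obtain rfl := List.map_eq_nil_iff.mp hx
      decide

/-! ### Rows of a ladder with flow -/

theorem rowAt_connects {u : List (Slice Strand)} {y : List Strand} (h : Connects [] u y) (m : ℕ) :
    Connects [] (u.take m) (rowAt u m) ∧ Connects (rowAt u m) (u.drop m) y := by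
  have key : ∀ (v : List (Slice Strand)) (z : List Strand), Connects [] v z →
      z = (v.getLast?.map Slice.top).getD [] := by
    intro v z hv
    rcases List.eq_nil_or_concat v with rfl | ⟨w, s, rfl⟩
    · exact hv.symm
    · rw [List.concat_eq_append] at hv ⊢
      obtain ⟨x, -, -, hx⟩ := (connects_append _ _ _ _).mp hv
      rw [List.getLast?_append]
      exact hx.symm
  rw [← List.take_append_drop m u] at h
  obtain ⟨z, h1, h2⟩ := (connects_append _ _ _ _).mp h
  have : z = rowAt u m := key _ _ h1
  exact this ▸ ⟨h1, h2⟩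

section Ladder

variable {ℓ n : ℕ} {F : FString}

theorem take_succ_eq {k : ℕ} (hk : k < F.length) :
    F.take (k + 1) = F.take k ++ [F.getD k (0, 0)] := by
  rw [List.take_add_one, List.getElem?_eq_getElem hk, List.getD_eq_getElem _ _ hk]
  rfl

theorem weightsAfter_zero (t : ℕ) :
    weightsAfter ℓ (F.take 0) t = if 1 ≤ t ∧ t ≤ ℓ then 3 else 0 := rfl

theorem weightsAfter_succ {k : ℕ} (hk : k < F.length) (t : ℕ) :
    weightsAfter ℓ (F.take (k + 1)) t =
      if t = (F.getD k (0, 0)).1 then weightsAfter ℓ (F.take k) t - (F.getD k (0, 0)).2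
      else if t = (F.getD k (0, 0)).1 + 1 then weightsAfter ℓ (F.take k) t + (F.getD k (0, 0)).2
      else weightsAfter ℓ (F.take k) t := by
  rw [take_succ_eq hk]
  simp only [weightsAfter, List.foldl_append, List.foldl_cons, List.foldl_nil]

theorem weightsAfter_le_three (hF : IsAdmissible ℓ n F) {k : ℕ} (hk : k ≤ F.length) (t : ℕ) :
    weightsAfter ℓ (F.take k) t ≤ 3 := by
  induction k generalizing t with
  | zero =>
    rw [weightsAfter_zero]
    split_ifs <;> omega
  | succ k ih =>
    obtain ⟨-, -, -, -, h⟩ := hF k hk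
    have h1 := ih (by omega) t
    rw [weightsAfter_succ hk]
    split_ifs with h2 h3
    · omega
    · rw [h3]
      exact h
    · exact h1

/-- The local picture of the `(k + 1)`-st operator of the string `F`. -/
def ladderStep (ℓ n : ℕ) (F : FString) (k : ℕ) : List (Slice Orientation) :=
  connect
    (orientations (weightsAfter ℓ (F.take k)) (List.range' 1 ((F.getD k (0, 0)).1 - 1)))
    (orientations (weightsAfter ℓ (F.take k))
      (List.range' ((F.getD k (0, 0)).1 + 2) (n - ((F.getD k (0, 0)).1 + 1))))
    .up
    (orientations (weightsAfter ℓ (F.take k)) [(F.getD k (0, 0)).1, (F.getD k (0, 0)).1 + 1])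
    (orientations (weightsAfter ℓ (F.take (k + 1))) [(F.getD k (0, 0)).1, (F.getD k (0, 0)).1 + 1])

theorem ladderWeb_take {k : ℕ} (hk : k ≤ F.length) :
    ladderWeb ℓ n (F.take k) = (List.range k).flatMap (ladderStep ℓ n F) := by
  unfold ladderWeb
  rw [List.length_take, min_eq_left hk, List.flatMap_def, List.flatMap_def]
  congr 1
  refine List.map_congr_left fun m hm => ?_
  have hm := List.mem_range.mp hm
  have h1 : (F.take k).getD m (0, 0) = F.getD m (0, 0) := by
    simp [List.getD_eq_getElem?_getD, hm]
  have h2 : (F.take k).take m = F.take m := by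
    rw [List.take_take, min_eq_left (by omega)]
  have h3 : (F.take k).take (m + 1) = F.take (m + 1) := by
    rw [List.take_take, min_eq_left (by omega)]
  simp only [h1, h2, h3]
  rfl

theorem ladderWeb_take_succ {k : ℕ} (hk : k < F.length) :
    ladderWeb ℓ n (F.take (k + 1)) = ladderWeb ℓ n (F.take k) ++ ladderStep ℓ n F k := by
  rw [ladderWeb_take hk, ladderWeb_take hk.le, List.range_succ, List.flatMap_append,
    List.flatMap_singleton]

theorem ladderWeb_eq_append {k : ℕ} (hk : k ≤ F.length) :
    ∃ v, ladderWeb ℓ n F = ladderWeb ℓ n (F.take k) ++ v := by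
  obtain ⟨m, hm⟩ := Nat.exists_eq_add_of_le hk
  refine ⟨((List.range m).map (k + ·)).flatMap (ladderStep ℓ n F), ?_⟩
  conv_lhs => rw [← List.take_length (l := F)]
  rw [ladderWeb_take le_rfl, ladderWeb_take hk, hm, List.range_add, List.flatMap_append]

/-- The row of strands of `u` after the first `k` operators of `F`. -/
def ladderRow (ℓ n : ℕ) (F : FString) (u : List (Slice Strand)) (k : ℕ) : List Strand :=
  rowAt u (ladderWeb ℓ n (F.take k)).length

variable {u : List (Slice Strand)}

/-- The slices of a web with flow on a ladder that belong to one operator lead from one row of the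
ladder to the next. -/
theorem exists_ladderStep_lift (hw : underlyingWeb u = ladderWeb ℓ n F) {y : List Strand}
    (hc : Connects [] u y) {k : ℕ} (hk : k < F.length) :
    ∃ v, v.map (Slice.map Prod.fst) = ladderStep ℓ n F k ∧ (∀ s ∈ v, s ∈ u) ∧
      u.take (ladderWeb ℓ n (F.take (k + 1))).length =
        u.take (ladderWeb ℓ n (F.take k)).length ++ v ∧
      Connects (ladderRow ℓ n F u k) v (ladderRow ℓ n F u (k + 1)) := by
  set h := (ladderWeb ℓ n (F.take k)).length with hh
  obtain ⟨w, hw'⟩ := ladderWeb_eq_append (ℓ := ℓ) (n := n) (show k + 1 ≤ F.length from hk)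
  have hlen : (ladderWeb ℓ n (F.take (k + 1))).length = h + (ladderStep ℓ n F k).length := by
    rw [ladderWeb_take_succ hk, List.length_append]
  have htake : u.take (h + (ladderStep ℓ n F k).length) =
      u.take h ++ (u.drop h).take (ladderStep ℓ n F k).length := List.take_add
  refine ⟨(u.drop h).take (ladderStep ℓ n F k).length, ?_, ?_, ?_, ?_⟩
  · rw [List.map_take, List.map_drop]
    change ((underlyingWeb u).drop h).take _ = _
    rw [hw, hw', ladderWeb_take_succ hk, List.append_assoc, hh, List.drop_left, List.take_left]
  · intro s hs
    exact List.mem_of_mem_drop (List.mem_of_mem_take hs)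
  · rw [hlen, htake]
  · obtain ⟨h1, -⟩ := rowAt_connects hc (h + (ladderStep ℓ n F k).length)
    obtain ⟨h2, -⟩ := rowAt_connects hc h
    rw [htake] at h1
    obtain ⟨z, h3, h4⟩ := (connects_append _ _ _ _).mp h1
    have huniq : ∀ (v : List (Slice Strand)) (x a b : List Strand), Connects x v a →
        Connects x v b → a = b := by
      intro v
      induction v with
      | nil => rintro x a b rfl rfl; rfl
      | cons s v ih => exact fun x a b ha hb => ih _ _ _ ha.2 hb.2
    rw [ladderRow, ladderRow, hlen, ← hh, huniq _ _ _ _ h2 h3]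
    exact h4

/-- The colours at position `t` of a row of strands over the weights `w`. -/
def rowColors (w : ℕ → ℕ) (row : List Strand) (t : ℕ) : Finset (Fin 3) :=
  colorOf (w t) row[(orientations w (List.range' 1 (t - 1))).length]?

theorem colorsAt_eq (k t : ℕ) :
    colorsAt ℓ n F u k t = rowColors (weightsAfter ℓ (F.take k)) (ladderRow ℓ n F u k) t := rfl

theorem colorOf_congr {w : ℕ} {o o' : Option Strand} (h : w ≠ 0 → w ≠ 3 → o = o') :
    colorOf w o = colorOf w o' := by
  unfold colorOf
  split_ifs with h1 h2
  · rfl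
  · rfl
  · rw [h h1 h2]

theorem orientations_append (w : ℕ → ℕ) (l l' : List ℕ) :
    orientations w (l ++ l') = orientations w l ++ orientations w l' := List.filterMap_append

theorem orientations_congr {w w' : ℕ → ℕ} {l : List ℕ} (h : ∀ t ∈ l, w t = w' t) :
    orientations w l = orientations w' l :=
  List.filterMap_congr fun t ht => by rw [h t ht]

theorem orientations_pair (w : ℕ → ℕ) (i : ℕ) :
    orientations w [i, i + 1] = pairOrientations (w i) (w (i + 1)) := by
  simp only [orientations, pairOrientations, List.filterMap_cons, List.filterMap_nil]

theorem exists_orientation {a : ℕ} (h0 : a ≠ 0) (h3 : a ≠ 3) (ha : a ≤ 3) :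
    ∃ o, orientationOfWeight a = some o := by
  obtain rfl | rfl : a = 1 ∨ a = 2 := by omega
  · exact ⟨_, rfl⟩
  · exact ⟨_, rfl⟩

theorem orientations_singleton (w : ℕ → ℕ) (t : ℕ) :
    (orientations w [t]).length = edgeCount (w t) := by
  simp only [orientations, edgeCount, List.filterMap_cons, List.filterMap_nil]

theorem edgeCount_eq_one {a : ℕ} (h0 : a ≠ 0) (h3 : a ≠ 3) (ha : a ≤ 3) : edgeCount a = 1 := by
  obtain ⟨o, ho⟩ := exists_orientation h0 h3 ha
  simp [edgeCount, ho]

theorem range'_split {n i : ℕ} (h1 : 1 ≤ i) (h2 : i < n) :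
    List.range' 1 n = List.range' 1 (i - 1) ++ [i, i + 1] ++ List.range' (i + 2) (n - (i + 1)) := by
  have e : n = (i - 1) + (2 + (n - (i + 1))) := by omega
  conv_lhs => rw [e, ← List.range'_append_1, ← List.range'_append_1]
  have e1 : 1 + (i - 1) = i := by omega
  rw [e1, List.append_assoc]
  rfl

section Row

variable {w : ℕ → ℕ} {L x R : List Strand} {i t : ℕ}

theorem rowColors_of_lt (hw : ∀ t, w t ≤ 3)
    (hL : L.map Prod.fst = orientations w (List.range' 1 (i - 1))) (h1 : 1 ≤ t) (h2 : t < i) :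
    rowColors w (L ++ x ++ R) t =
      colorOf (w t) L[(orientations w (List.range' 1 (t - 1))).length]? := by
  refine colorOf_congr fun h0 h3 => ?_
  rw [List.append_assoc, List.getElem?_append_left]
  have hlen : L.length = (orientations w (List.range' 1 (i - 1))).length := by
    rw [← hL, List.length_map]
  have e : List.range' 1 (i - 1) =
      List.range' 1 (t - 1) ++ ([t] ++ List.range' (t + 1) (i - 1 - t)) := by
    have : i - 1 = (t - 1) + (1 + (i - 1 - t)) := by omega
    conv_lhs => rw [this, ← List.range'_append_1, ← List.range'_append_1]
    have e1 : 1 + (t - 1) = t := by omega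
    rw [e1]
    rfl
  rw [hlen, e, orientations_append, orientations_append, List.length_append, List.length_append,
    orientations_singleton, edgeCount_eq_one h0 h3 (hw t)]
  omega

theorem rowColors_left (hw : ∀ t, w t ≤ 3)
    (hL : L.map Prod.fst = orientations w (List.range' 1 (i - 1)))
    (hx : x.map Prod.fst = pairOrientations (w i) (w (i + 1))) :
    rowColors w (L ++ x ++ R) i = colorOf (w i) x[0]? := by
  refine colorOf_congr fun h0 h3 => ?_
  have hlen : L.length = (orientations w (List.range' 1 (i - 1))).length := by
    rw [← hL, List.length_map]
  obtain ⟨o, ho⟩ := exists_orientation h0 h3 (hw i)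
  have hx0 : 0 < x.length := by
    rw [← List.length_map (f := Prod.fst), hx]
    simp [pairOrientations, ho]
  rw [List.append_assoc, List.getElem?_append_right (by omega), hlen, Nat.sub_self,
    List.getElem?_append_left hx0]

theorem rowColors_right (hw : ∀ t, w t ≤ 3) (hi : 1 ≤ i)
    (hL : L.map Prod.fst = orientations w (List.range' 1 (i - 1)))
    (hx : x.map Prod.fst = pairOrientations (w i) (w (i + 1))) :
    rowColors w (L ++ x ++ R) (i + 1) = colorOf (w (i + 1)) x[edgeCount (w i)]? := by
  refine colorOf_congr fun h0 h3 => ?_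
  have hlen : L.length = (orientations w (List.range' 1 (i - 1))).length := by
    rw [← hL, List.length_map]
  have e : List.range' 1 (i + 1 - 1) = List.range' 1 (i - 1) ++ [i] := by
    have : i + 1 - 1 = (i - 1) + 1 := by omega
    rw [this, ← List.range'_append_1]
    have e1 : 1 + (i - 1) = i := by omega
    rw [e1]
    rfl
  have hx0 : edgeCount (w i) < x.length := by
    obtain ⟨o, ho⟩ := exists_orientation h0 h3 (hw (i + 1))
    rw [← List.length_map (f := Prod.fst), hx, pairOrientations, edgeCount,
      show [w i, w (i + 1)] = [w i] ++ [w (i + 1)] from rfl, List.filterMap_append,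
      List.length_append]
    simp [ho]
  rw [e, orientations_append, List.length_append, orientations_singleton, List.append_assoc,
    List.getElem?_append_right (by omega), hlen, Nat.add_sub_cancel_left,
    List.getElem?_append_left hx0]

theorem rowColors_of_gt (hi : 1 ≤ i)
    (hL : L.map Prod.fst = orientations w (List.range' 1 (i - 1)))
    (hx : x.map Prod.fst = pairOrientations (w i) (w (i + 1))) (h : i + 1 < t) :
    rowColors w (L ++ x ++ R) t =
      colorOf (w t) R[(orientations w (List.range' (i + 2) (t - 1 - (i + 1)))).length]? := by
  refine colorOf_congr fun h0 h3 => ?_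
  have hlen : (L ++ x).length = (orientations w (List.range' 1 (i - 1) ++ [i, i + 1])).length := by
    rw [orientations_append, ← hL, orientations_pair, ← hx, List.length_append,
      List.length_append, List.length_map, List.length_map]
  rw [range'_split (n := t - 1) hi (by omega), orientations_append, List.length_append,
    List.getElem?_append_right (by omega), hlen, Nat.add_sub_cancel_left]

end Row

/-- The effect of one operator on the colours: it moves the colours that leave position `i` to
position `i + 1`. -/
theorem ladder_step (hF : IsAdmissible ℓ n F) (hw : underlyingWeb u = ladderWeb ℓ n F)
    (hf : ∀ s ∈ u, (s.piece.map Prod.snd).IsFlow) {y : List Strand} (hc : Connects [] u y)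
    {k : ℕ} (hk : k < F.length)
    (hrow : (ladderRow ℓ n F u k).map Prod.fst =
      orientations (weightsAfter ℓ (F.take k)) (List.range' 1 n)) :
    (ladderRow ℓ n F u (k + 1)).map Prod.fst =
      orientations (weightsAfter ℓ (F.take (k + 1))) (List.range' 1 n) ∧
    movedColors ℓ n F u k ⊆ colorsAt ℓ n F u k (F.getD k (0, 0)).1 ∧
    Disjoint (movedColors ℓ n F u k) (colorsAt ℓ n F u k ((F.getD k (0, 0)).1 + 1)) ∧
    (∀ t, 1 ≤ t → ∀ c, c ∈ colorsAt ℓ n F u (k + 1) t ↔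
      (c ∈ colorsAt ℓ n F u k t ∧ ¬ (c ∈ movedColors ℓ n F u k ∧ t = (F.getD k (0, 0)).1)) ∨
        (c ∈ movedColors ℓ n F u k ∧ t = (F.getD k (0, 0)).1 + 1)) ∧
    weight (u.take (ladderWeb ℓ n (F.take (k + 1))).length) =
      weight (u.take (ladderWeb ℓ n (F.take k)).length) -
        localDeg (colorsAt ℓ n F u k (F.getD k (0, 0)).1)
          (colorsAt ℓ n F u k ((F.getD k (0, 0)).1 + 1)) (movedColors ℓ n F u k) := by
  obtain ⟨v, hv, hvu, htake, hvc⟩ := exists_ladderStep_lift hw hc hk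
  obtain ⟨hi1, hin, hj1, hja, hjb⟩ := hF k hk
  have hw3 := weightsAfter_le_three hF hk.le
  have hw3' := weightsAfter_le_three hF (show k + 1 ≤ F.length from hk)
  have hws := weightsAfter_succ (ℓ := ℓ) hk
  unfold movedColors
  rw [htake, weight_append]
  simp only [colorsAt_eq]
  unfold ladderStep at hv
  generalize (F.getD k (0, 0)).1 = i at *
  generalize (F.getD k (0, 0)).2 = j at *
  generalize weightsAfter ℓ (F.take k) = w at *
  generalize weightsAfter ℓ (F.take (k + 1)) = w' at *
  generalize ladderRow ℓ n F u k = row at *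
  generalize ladderRow ℓ n F u (k + 1) = row' at *
  have hwi : w' i = w i - j := by simp [hws]
  have hwi1 : w' (i + 1) = w (i + 1) + j := by simp [hws]
  have hwne : ∀ t, t ≠ i → t ≠ i + 1 → w' t = w t := fun t h1 h2 => by simp [hws, h1, h2]
  rw [range'_split hi1 hin, orientations_append, orientations_append] at hrow
  obtain ⟨Lx, R, rfl, hLx, hR⟩ := List.map_eq_append_iff.mp hrow
  obtain ⟨L, x, rfl, hL, hx⟩ := List.map_eq_append_iff.mp hLx
  rw [orientations_pair] at hx
  rw [← hL, ← hR, connect_eq_frame, orientations_pair, orientations_pair, hwi, hwi1] at hv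
  obtain ⟨v, y', rfl, hv', hvc', rfl⟩ := exists_unframe L R x v row' _ hv hvc
  obtain ⟨hy, hs1, hs2, hs3, hs4⟩ := isColorStep_of_flow hj1 hja (hw3 i) hjb hvc' hx hv'
    (fun s hs => hf (Slice.frame L R s) (hvu _ (List.mem_map_of_mem hs)))
  have hbefore : orientations w' (List.range' 1 (i - 1)) =
      orientations w (List.range' 1 (i - 1)) := by
    refine orientations_congr fun t ht => ?_
    rw [List.mem_range'_1] at ht
    exact hwne t (by omega) (by omega)
  have hafter : ∀ m, orientations w' (List.range' (i + 2) m) =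
      orientations w (List.range' (i + 2) m) := by
    intro m
    refine orientations_congr fun t ht => ?_
    rw [List.mem_range'_1] at ht
    exact hwne t (by omega) (by omega)
  have hL' : L.map Prod.fst = orientations w' (List.range' 1 (i - 1)) := by rw [hL, hbefore]
  rw [← hwi, ← hwi1] at hy
  rw [← hwi] at hs1 hs2 hs3 hs4
  rw [← hwi1] at hs3
  have c1 : rowColors w (L ++ x ++ R) i = colorOf (w i) x[0]? := rowColors_left hw3 hL hx
  have c2 : rowColors w (L ++ x ++ R) (i + 1) = colorOf (w (i + 1)) x[edgeCount (w i)]? :=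
    rowColors_right hw3 hi1 hL hx
  have c3 : rowColors w' (L ++ y' ++ R) i = colorOf (w' i) y'[0]? := rowColors_left hw3' hL' hy
  have c4 : rowColors w' (L ++ y' ++ R) (i + 1) = colorOf (w' (i + 1)) y'[edgeCount (w' i)]? :=
    rowColors_right hw3' hi1 hL' hy
  have c5 : ∀ t, 1 ≤ t → t ≠ i → t ≠ i + 1 →
      rowColors w' (L ++ y' ++ R) t = rowColors w (L ++ x ++ R) t := by
    intro t h1 h2 h3
    rcases lt_or_gt_of_ne h2 with h4 | h4
    · rw [rowColors_of_lt hw3 hL h1 h4, rowColors_of_lt hw3' hL' h1 h4, hwne t h2 h3]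
      congr 3
      refine orientations_congr fun s hs => ?_
      rw [List.mem_range'_1] at hs
      exact hwne s (by omega) (by omega)
    · have h5 : i + 1 < t := by omega
      rw [rowColors_of_gt hi1 hL hx h5, rowColors_of_gt hi1 hL' hy h5, hwne t h2 h3, hafter]
  rw [c1, c2, c3]
  refine ⟨?_, Finset.sdiff_subset, hs2, ?_, ?_⟩
  · rw [range'_split hi1 hin, orientations_append, orientations_append, hbefore, hafter,
      orientations_pair, List.map_append, List.map_append, hL, hy, hR]
  · intro t ht c
    by_cases h1 : t = i
    · subst h1
      rw [c1, c3]
      have := @hs1 c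
      simp only [Finset.mem_sdiff]
      constructor
      · intro h
        exact Or.inl ⟨this h, fun h' => h'.1.2 h⟩
      · rintro (⟨h, h'⟩ | ⟨-, h⟩)
        · by_contra hc
          exact h' ⟨⟨h, hc⟩, trivial⟩
        · omega
    · by_cases h2 : t = i + 1
      · subst h2
        rw [c2, c4, hs3, Finset.mem_union]
        simp
      · rw [c5 t ht h1 h2]
        simp [h1, h2]
  · rw [weight_map_frame, hs4]
    ring

end Ladder

/-! ### The filling of a ladder with flow -/

theorem addNodes_of_mem {ℓ k i : ℕ} {T : Filling} {M : Finset (Fin 3)} {N : Node}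
    (h : N.1 ∈ M ∧ residue ℓ N = i ∧ IsAddable {N' | T N' ≠ 0} N) :
    addNodes ℓ T k i M N = k := if_pos h

theorem addNodes_of_not_mem {ℓ k i : ℕ} {T : Filling} {M : Finset (Fin 3)} {N : Node}
    (h : ¬ (N.1 ∈ M ∧ residue ℓ N = i ∧ IsAddable {N' | T N' ≠ 0} N)) :
    addNodes ℓ T k i M N = T N := if_neg h

theorem antitone_add_node {f : ℕ → ℕ} (hf : Antitone f) {r : ℕ}
    (hr : (f r : ℤ) - r + 1 ∉ beads f) : Antitone (Function.update f r (f r + 1)) := by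
  intro s t hst
  have h1 := hf hst
  have h2 := (forall_lt_row_iff hf r).mpr hr
  by_cases ht : t = r
  · subst ht
    by_cases hs : s = t
    · subst hs
      exact le_rfl
    · have := h2 s (by omega)
      rw [Function.update_self, Function.update_of_ne hs]
      omega
  · rw [Function.update_of_ne ht]
    by_cases hs : s = r
    · subst hs
      rw [Function.update_self]
      omega
    · rwa [Function.update_of_ne hs]

/-- Adding nodes of a residue moves beads from the position of this residue to the next one. -/
theorem addNodes_spec {ℓ k i : ℕ} {T : Filling} {f : Fin 3 → ℕ → ℕ} (hf : ∀ c, Antitone (f c))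
    (hT : {N | T N ≠ 0} = rowsDiagram f) {M : Finset (Fin 3)}
    (hM : ∀ c ∈ M, (i : ℤ) - ℓ ∈ beads (f c) ∧ (i : ℤ) - ℓ + 1 ∉ beads (f c)) (hk : k ≠ 0) :
    ∃ f' : Fin 3 → ℕ → ℕ, (∀ c, Antitone (f' c)) ∧
      {N | addNodes ℓ T k i M N ≠ 0} = rowsDiagram f' ∧
      ∀ c l, l ∈ beads (f' c) ↔
        (l ∈ beads (f c) ∧ ¬ (c ∈ M ∧ l = (i : ℤ) - ℓ)) ∨ (c ∈ M ∧ l = (i : ℤ) - ℓ + 1) := by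
  have hadd : ∀ c r q, (addNodes ℓ T k i M (c, r, q) ≠ 0 ↔
      (c ∈ M ∧ (q : ℤ) - r = (i : ℤ) - ℓ ∧ q = f c r) ∨ q < f c r) := by
    intro c r q
    have h0 : T (c, r, q) ≠ 0 ↔ q < f c r := Set.ext_iff.mp hT (c, r, q)
    by_cases h : c ∈ M ∧ residue ℓ (c, r, q) = i ∧ IsAddable {N' | T N' ≠ 0} (c, r, q)
    · rw [addNodes_of_mem h]
      rw [hT, isAddable_rowsDiagram_iff hf] at h
      simp only [residue] at h
      exact ⟨fun _ => Or.inl ⟨h.1, by omega, h.2.2.1.symm⟩, fun _ => hk⟩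
    · rw [addNodes_of_not_mem h, h0]
      rw [hT, isAddable_rowsDiagram_iff hf] at h
      simp only [residue] at h
      constructor
      · exact Or.inr
      · rintro (⟨h1, h2, h3⟩ | h1)
        · refine absurd ⟨h1, by omega, h3.symm, ?_⟩ h
          rw [h2]
          exact (hM c h1).2
        · exact h1
  choose! r hr using fun c (hc : c ∈ M) => mem_beads.mp (hM c hc).1
  have hanti : ∀ c ∈ M, Antitone (Function.update (f c) (r c) (f c (r c) + 1)) := fun c hc =>
    antitone_add_node (hf c) (by rw [hr c hc]; exact (hM c hc).2)
  refine ⟨fun c => if c ∈ M then Function.update (f c) (r c) (f c (r c) + 1) else f c, ?_, ?_, ?_⟩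
  · intro c
    by_cases hc : c ∈ M
    · simp only [hc, if_true]
      exact hanti c hc
    · simp only [hc, if_false]
      exact hf c
  · ext ⟨c, s, q⟩
    simp only [Set.mem_ofPred_eq, rowsDiagram]
    rw [hadd]
    by_cases hc : c ∈ M
    · simp only [hc, if_true, true_and]
      by_cases hs : s = r c
      · subst hs
        rw [Function.update_self]
        have := hr c hc
        omega
      · rw [Function.update_of_ne hs]
        have : ¬ ((q : ℤ) - s = (i : ℤ) - ℓ ∧ q = f c s) := by
          rintro ⟨h1, h2⟩
          exact hs (row_eq_of_bead_eq (hf c) (by rw [hr c hc]; omega))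
        simp [this]
    · simp [hc]
  · intro c l
    by_cases hc : c ∈ M
    · simp only [hc, if_true, true_and]
      rw [(beads_of_add_node (hf c) (hanti c hc) (r := r c) (q := f c (r c)) ?_
        (lt_irrefl _)).2.2 l, hr c hc]
      intro s q
      by_cases hs : s = r c
      · subst hs
        rw [Function.update_self]
        omega
      · simp [hs]
    · simp [hc]

section Ladder

variable {ℓ n : ℕ} {F : FString} {u : List (Slice Strand)}

theorem ladderWeb_take_zero : ladderWeb ℓ n (F.take 0) = [] := rfl

theorem ladderRow_orientations (hF : IsAdmissible ℓ n F) (hw : underlyingWeb u = ladderWeb ℓ n F)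
    (hf : ∀ s ∈ u, (s.piece.map Prod.snd).IsFlow) {y : List Strand} (hc : Connects [] u y)
    {k : ℕ} (hk : k ≤ F.length) :
    (ladderRow ℓ n F u k).map Prod.fst =
      orientations (weightsAfter ℓ (F.take k)) (List.range' 1 n) := by
  induction k with
  | zero =>
    have h1 : ladderRow ℓ n F u 0 = [] := rfl
    rw [h1, List.map_nil]
    symm
    refine List.filterMap_eq_nil_iff.mpr fun t _ => ?_
    rw [weightsAfter_zero]
    split_ifs <;> rfl
  | succ k ih => exact (ladder_step hF hw hf hc hk (ih (by omega))).1

theorem ladderRow_length (hw : underlyingWeb u = ladderWeb ℓ n F) {y : List Strand}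
    (hc : Connects [] u y) : ladderRow ℓ n F u F.length = y := by
  have h := (rowAt_connects hc (ladderWeb ℓ n F).length).2
  have hlen : (ladderWeb ℓ n F).length = u.length := by
    rw [← hw, underlyingWeb, List.length_map]
  rw [ladderRow, List.take_length]
  rw [hlen] at h ⊢
  rw [List.drop_length] at h
  exact h

/-- After each step, the filled nodes form a diagram, and its beads are given by the colours. -/
theorem exists_rows_iotaSteps (hℓ : ℓ ≤ n) (hF : IsAdmissible ℓ n F)
    (hw : underlyingWeb u = ladderWeb ℓ n F)
    (hf : ∀ s ∈ u, (s.piece.map Prod.snd).IsFlow) {y : List Strand} (hc : Connects [] u y)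
    {k : ℕ} (hk : k ≤ F.length) :
    ∃ f : Fin 3 → ℕ → ℕ, (∀ c, Antitone (f c)) ∧
      {N | iotaSteps ℓ n F u k N ≠ 0} = rowsDiagram f ∧
      ∀ c l, l ∈ beads (f c) ↔
        l + ℓ ≤ 0 ∨ ∃ t : ℕ, 1 ≤ t ∧ t ≤ n ∧ (t : ℤ) = l + ℓ ∧ c ∈ colorsAt ℓ n F u k t := by
  induction k with
  | zero =>
    refine ⟨fun _ _ => 0, fun _ _ _ _ => le_rfl, ?_, ?_⟩
    · ext N
      simp [iotaSteps, rowsDiagram]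
    · intro c l
      have hcol : ∀ t, c ∈ colorsAt ℓ n F u 0 t ↔ 1 ≤ t ∧ t ≤ ℓ := by
        intro t
        rw [colorsAt_eq, rowColors, colorOf, weightsAfter_zero]
        split_ifs <;> simp_all
      rw [mem_beads]
      simp only [hcol]
      constructor
      · rintro ⟨r, rfl⟩
        by_cases hr : ℓ ≤ r
        · left
          push_cast
          omega
        · right
          exact ⟨ℓ - r, by omega, by omega, by push_cast; omega, by omega, by omega⟩
      · rintro (h | ⟨t, h1, h2, h3, h4, h5⟩)
        · exact ⟨(-l).toNat, by push_cast; omega⟩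
        · exact ⟨(-l).toNat, by push_cast; omega⟩
  | succ k ih =>
    obtain ⟨f, hanti, hdiag, hbeads⟩ := ih (by omega)
    have hrow := ladderRow_orientations hF hw hf hc (show k ≤ F.length by omega)
    obtain ⟨-, h1, h2, h3, -⟩ := ladder_step hF hw hf hc hk hrow
    obtain ⟨hi1, hin, -⟩ := hF k hk
    have hat : ∀ t c, 1 ≤ t → t ≤ n →
        ((t : ℤ) - ℓ ∈ beads (f c) ↔ c ∈ colorsAt ℓ n F u k t) := by
      intro t c ht1 htn
      rw [hbeads]
      constructor
      · rintro (h | ⟨t', -, -, h, h'⟩)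
        · omega
        · have : t' = t := by omega
          exact this ▸ h'
      · intro h
        exact Or.inr ⟨t, ht1, htn, by ring, h⟩
    have hM : ∀ c ∈ movedColors ℓ n F u k,
        (((F.getD k (0, 0)).1 : ℕ) : ℤ) - ℓ ∈ beads (f c) ∧
        (((F.getD k (0, 0)).1 : ℕ) : ℤ) - ℓ + 1 ∉ beads (f c) := by
      intro c hcM
      refine ⟨(hat _ c hi1 hin.le).mpr (h1 hcM), fun h => ?_⟩
      have h' := (hat ((F.getD k (0, 0)).1 + 1) c (by omega) hin).mp (by
        push_cast
        convert h using 1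
        ring)
      exact Finset.disjoint_left.mp h2 hcM h'
    obtain ⟨f', hanti', hdiag', hbeads'⟩ := addNodes_spec hanti hdiag hM (Nat.succ_ne_zero k)
    refine ⟨f', hanti', hdiag', fun c l => ?_⟩
    rw [hbeads', hbeads]
    constructor
    · rintro (⟨h | ⟨t, ht1, htn, htl, ht⟩, h'⟩ | ⟨hcM, rfl⟩)
      · exact Or.inl h
      · refine Or.inr ⟨t, ht1, htn, htl, (h3 t ht1 c).mpr (Or.inl ⟨ht, fun h'' => h' ⟨h''.1, ?_⟩⟩)⟩
        have := h''.2
        omega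
      · exact Or.inr ⟨(F.getD k (0, 0)).1 + 1, by omega, hin, by push_cast; ring,
          (h3 _ (by omega) c).mpr (Or.inr ⟨hcM, rfl⟩)⟩
    · rintro (h | ⟨t, ht1, htn, htl, ht⟩)
      · exact Or.inl ⟨Or.inl h, fun h' => by have := h'.2; omega⟩
      · rcases (h3 t ht1 c).mp ht with ⟨h4, h5⟩ | ⟨h4, h5⟩
        · refine Or.inl ⟨Or.inr ⟨t, ht1, htn, htl, h4⟩, fun h' => h5 ⟨h'.1, ?_⟩⟩
          have := h'.2
          omega
        · exact Or.inr ⟨h4, by rw [h5] at htl; push_cast at htl; omega⟩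

theorem iotaSteps_le (k : ℕ) (N : Node) : iotaSteps ℓ n F u k N ≤ k := by
  induction k with
  | zero => exact le_rfl
  | succ k ih =>
    rw [iotaSteps]
    by_cases h : N.1 ∈ movedColors ℓ n F u k ∧ residue ℓ N = ((F.getD k (0, 0)).1 : ℕ) ∧
        IsAddable {N' | iotaSteps ℓ n F u k N' ≠ 0} N
    · rw [addNodes_of_mem h]
    · rw [addNodes_of_not_mem h]
      exact ih.trans (Nat.le_succ k)

/-- An entry of the filling is never overwritten. -/
theorem iotaSteps_stable {j k : ℕ} (hjk : j ≤ k) (N : Node) :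
    iotaSteps ℓ n F u k N = iotaSteps ℓ n F u j N ∨
      (iotaSteps ℓ n F u j N = 0 ∧ j < iotaSteps ℓ n F u k N) := by
  induction k, hjk using Nat.le_induction with
  | base => exact Or.inl rfl
  | succ k hjk ih =>
    rw [show iotaSteps ℓ n F u (k + 1) = addNodes ℓ (iotaSteps ℓ n F u k) (k + 1)
      (F.getD k (0, 0)).1 (movedColors ℓ n F u k) from rfl]
    by_cases h : N.1 ∈ movedColors ℓ n F u k ∧ residue ℓ N = ((F.getD k (0, 0)).1 : ℕ) ∧
        IsAddable {N' | iotaSteps ℓ n F u k N' ≠ 0} N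
    · rw [addNodes_of_mem h]
      have h0 : iotaSteps ℓ n F u k N = 0 := by
        by_contra hne
        exact h.2.2.1 hne
      rcases ih with h1 | ⟨h1, h2⟩
      · exact Or.inr ⟨by omega, by omega⟩
      · omega
    · rw [addNodes_of_not_mem h]
      exact ih

/-- The nodes with entry `j + 1` are those added in step `j + 1`. -/
theorem iotaSteps_eq_succ {j k : ℕ} (hjk : j + 1 ≤ k) {N : Node} :
    iotaSteps ℓ n F u k N = j + 1 ↔ N.1 ∈ movedColors ℓ n F u j ∧
      residue ℓ N = ((F.getD j (0, 0)).1 : ℕ) ∧ IsAddable {N' | iotaSteps ℓ n F u j N' ≠ 0} N := by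
  have hlt := iotaSteps_le (ℓ := ℓ) (n := n) (F := F) (u := u) j N
  have h1 : iotaSteps ℓ n F u k N = j + 1 ↔ iotaSteps ℓ n F u (j + 1) N = j + 1 := by
    have := iotaSteps_le (ℓ := ℓ) (n := n) (F := F) (u := u) (j + 1) N
    rcases iotaSteps_stable (ℓ := ℓ) (n := n) (F := F) (u := u) hjk N with h | ⟨h, h'⟩ <;> omega
  rw [h1, iotaSteps]
  by_cases h : N.1 ∈ movedColors ℓ n F u j ∧ residue ℓ N = ((F.getD j (0, 0)).1 : ℕ) ∧
      IsAddable {N' | iotaSteps ℓ n F u j N' ≠ 0} N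
  · rw [addNodes_of_mem h]
    exact ⟨fun _ => h, fun _ => rfl⟩
  · rw [addNodes_of_not_mem h]
    exact ⟨fun h2 => by omega, fun h2 => absurd h2 h⟩

theorem iotaSteps_le_iff {j k : ℕ} (hjk : j ≤ k) (N : Node) :
    (iotaSteps ℓ n F u k N ≠ 0 ∧ iotaSteps ℓ n F u k N ≤ j) ↔ iotaSteps ℓ n F u j N ≠ 0 := by
  have hlt := iotaSteps_le (ℓ := ℓ) (n := n) (F := F) (u := u) j N
  rcases iotaSteps_stable (ℓ := ℓ) (n := n) (F := F) (u := u) hjk N with h | ⟨h, h'⟩ <;> omega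

end Ladder

/-! ### The degree of the filling of a ladder with flow -/

theorem edgeCount_card_colors (s : Symbol) : edgeCount s.colors.card = (strands [s]).length := by
  rcases s with _ | _ | ⟨_ | _, _ | _ | _⟩ <;> decide

theorem colorOf_card_colors (s : Symbol) (l : List Strand) :
    colorOf s.colors.card (strands [s] ++ l)[0]? = s.colors := by
  rcases s with _ | _ | s
  · rfl
  · rfl
  · change colorOf (strandColors s).card (some s) = strandColors s
    rcases s with ⟨_ | _, _ | _ | _⟩ <;> decide

section Ladder

variable {ℓ : ℕ} {D : List Symbol} {F : FString} {u : List (Slice Strand)}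

theorem colorsAt_length
    (hwt : ∀ t < D.length, weightsAfter ℓ F (t + 1) = (D.getD t Symbol.circ).colors.card)
    (hw : underlyingWeb u = ladderWeb ℓ D.length F) (hc : Connects [] u (strands D)) {t : ℕ}
    (ht : t < D.length) :
    colorsAt ℓ D.length F u F.length (t + 1) = (D.getD t Symbol.circ).colors := by
  have hidx : ∀ t ≤ D.length, (orientations (weightsAfter ℓ F) (List.range' 1 t)).length =
      (strands (D.take t)).length := by
    intro t ht
    induction t with
    | zero => rfl
    | succ t ih =>
      have h1 : List.range' 1 (t + 1) = List.range' 1 t ++ [t + 1] := by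
        rw [← List.range'_append_1, add_comm 1 t]
        rfl
      have h2 : D.take (t + 1) = D.take t ++ [D.getD t Symbol.circ] := by
        have ht : t < D.length := ht
        rw [List.take_add_one, List.getElem?_eq_getElem ht, List.getD_eq_getElem _ _ ht]
        rfl
      rw [h1, h2, orientations_append, strands_append, List.length_append, List.length_append,
        ih (by omega), orientations_singleton, hwt t ht, edgeCount_card_colors]
  have hsplit : D = D.take t ++ ([D.getD t Symbol.circ] ++ D.drop (t + 1)) := by
    rw [List.getD_eq_getElem _ _ ht, List.singleton_append, ← List.drop_eq_getElem_cons ht,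
      List.take_append_drop]
  have hrow : (strands D)[(strands (D.take t)).length]? =
      (strands [D.getD t Symbol.circ] ++ strands (D.drop (t + 1)))[0]? := by
    conv_lhs => rw [hsplit, strands_append, strands_append]
    rw [List.take_left' (by simp; omega), List.getElem?_append_right le_rfl, Nat.sub_self]
  rw [colorsAt_eq, rowColors, ladderRow_length hw hc, List.take_length, Nat.add_sub_cancel,
    hidx t ht.le, hwt t ht, hrow, colorOf_card_colors]

theorem mem_shape_iff_iota (hD : ∀ c : Fin 3, (column D c).card = ℓ)
    (hu : u ∈ ladderFlowWebs ℓ F D) (N : Node) :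
    iota ℓ D.length F u N ≠ 0 ↔ N.2 ∈ shape D N.1 := by
  obtain ⟨⟨-, hflow, hconn⟩, hF, hwt, hund⟩ := hu
  have hℓ : ℓ ≤ D.length := by
    have := add_maxCols_shape_le hD
    omega
  obtain ⟨f, hanti, hdiag, hbeads⟩ := exists_rows_iotaSteps hℓ hF hund hflow hconn le_rfl
  obtain ⟨c, r, q⟩ := N
  rw [mem_shape_iff (hanti c) (fun l => ?_)]
  · exact Set.ext_iff.mp hdiag (c, r, q)
  · rw [hbeads, hD]
    refine or_congr Iff.rfl ⟨?_, ?_⟩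
    · rintro ⟨t, ht1, htn, htl, ht⟩
      refine ⟨t, mem_column.mpr ⟨⟨ht1, htn⟩, ?_⟩, htl⟩
      rw [← colorsAt_length hwt hund hconn (by omega), Nat.sub_add_cancel ht1]
      exact ht
    · rintro ⟨x, hx, hxl⟩
      obtain ⟨⟨h1, h2⟩, h3⟩ := mem_column.mp hx
      refine ⟨x, h1, h2, hxl, ?_⟩
      rw [← colorsAt_length hwt hund hconn (by omega), Nat.sub_add_cancel h1] at h3
      exact h3

theorem isStandard_iota (hD : ∀ c : Fin 3, (column D c).card = ℓ)
    (hu : u ∈ ladderFlowWebs ℓ F D) :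
    IsStandard F.length (shape D) (iota ℓ D.length F u) := by
  have hmem := mem_shape_iff_iota hD hu
  obtain ⟨⟨-, hflow, hconn⟩, hF, hwt, hund⟩ := hu
  have hℓ : ℓ ≤ D.length := by
    have := add_maxCols_shape_le hD
    omega
  have hle : ∀ N, iota ℓ D.length F u N ≤ F.length := iotaSteps_le F.length
  have hstep : ∀ N, iota ℓ D.length F u N ≠ 0 → ∃ j, iota ℓ D.length F u N = j + 1 ∧
      j + 1 ≤ F.length := fun N h =>
    ⟨iota ℓ D.length F u N - 1, by omega, by have := hle N; omega⟩
  -- Both nodes are added to the same diagram at the same residue.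
  have hsame : ∀ M N, iota ℓ D.length F u M ≠ 0 → iota ℓ D.length F u M = iota ℓ D.length F u N →
      residue ℓ M = residue ℓ N ∧ (M.1 = N.1 → M = N) := by
    intro M N h0 h
    obtain ⟨j, hj, hjF⟩ := hstep M h0
    have hM := (iotaSteps_eq_succ hjF).mp hj
    have hN := (iotaSteps_eq_succ hjF).mp (h ▸ hj)
    refine ⟨hM.2.1.trans hN.2.1.symm, fun hcomp => ?_⟩
    obtain ⟨f, hanti, hdiag, -⟩ :=
      exists_rows_iotaSteps hℓ hF hund hflow hconn (show j ≤ F.length by omega)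
    have h1 := hM.2.2
    have h2 := hN.2.2
    have h3 := hM.2.1.trans hN.2.1.symm
    rw [hdiag, isAddable_rowsDiagram_iff hanti] at h1 h2
    obtain ⟨c, r, q⟩ := M
    obtain ⟨c', r', q'⟩ := N
    obtain rfl : c = c' := hcomp
    simp only [residue] at h1 h2 h3
    obtain rfl : r = r' := row_eq_of_bead_eq (hanti c) (by omega)
    simp only [Prod.mk.injEq, true_and]
    omega
  have hlower : ∀ c r₁ q₁ r₂ q₂, r₁ ≤ r₂ → q₁ ≤ q₂ → (r₂, q₂) ∈ shape D c →
      iota ℓ D.length F u (c, r₁, q₁) ≤ iota ℓ D.length F u (c, r₂, q₂) := by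
    intro c r₁ q₁ r₂ q₂ hr hq h
    obtain ⟨f, hanti, hdiag, -⟩ := exists_rows_iotaSteps hℓ hF hund hflow hconn
      (hle (c, r₂, q₂))
    have h2 := (iotaSteps_le_iff (hle (c, r₂, q₂)) (c, r₂, q₂)).mp ⟨(hmem _).mpr h, le_rfl⟩
    have h3 : q₂ < f c r₂ := (Set.ext_iff.mp hdiag (c, r₂, q₂)).mp h2
    have h4 : q₁ < f c r₁ := by
      have := hanti c hr
      omega
    have h5 := (Set.ext_iff.mp hdiag (c, r₁, q₁)).mpr h4
    exact ((iotaSteps_le_iff (hle (c, r₂, q₂)) (c, r₁, q₁)).mpr h5).2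
  refine ⟨hmem, hle, ?_, ?_, ?_⟩
  · intro c r q₁ q₂ hq h
    refine lt_of_le_of_ne (hlower c r q₁ r q₂ le_rfl hq.le h) fun heq => ?_
    have := (hsame (c, r, q₂) (c, r, q₁) ((hmem _).mpr h) heq.symm).1
    simp only [residue] at this
    omega
  · intro c r₁ r₂ q hr h
    refine lt_of_le_of_ne (hlower c r₁ q r₂ q hr.le le_rfl h) fun heq => ?_
    have := (hsame (c, r₂, q) (c, r₁, q) ((hmem _).mpr h) heq.symm).1
    simp only [residue] at this
    omega
  · intro M N h0 h hne
    obtain ⟨h1, h2⟩ := hsame M N h0 h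
    refine ⟨fun hc => hne (h2 hc), ?_⟩
    simp only [residue] at h1 ⊢
    omega

/-- The tower of weight diagrams of `ι(u)` consists of the rows of `u`. -/
theorem stepDegree_iota (hD : ∀ c : Fin 3, (column D c).card = ℓ)
    (hu : u ∈ ladderFlowWebs ℓ F D) {j : ℕ} (hj : j < F.length) :
    stepDegree (shape D) (iota ℓ D.length F u) (j + 1) =
      localDeg (colorsAt ℓ D.length F u j (F.getD j (0, 0)).1)
        (colorsAt ℓ D.length F u j ((F.getD j (0, 0)).1 + 1)) (movedColors ℓ D.length F u j) := by
  have hT := isStandard_iota hD hu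
  have hmem := mem_shape_iff_iota hD hu
  obtain ⟨⟨-, hflow, hconn⟩, hF, hwt, hund⟩ := hu
  have hℓ : ℓ ≤ D.length := by
    have := add_maxCols_shape_le hD
    omega
  obtain ⟨f, hanti, hdiag, hbeads⟩ := exists_rows_iotaSteps hℓ hF hund hflow hconn hj.le
  obtain ⟨hi1, hin, -⟩ := hF j hj
  have hrows : ∀ c, rowCount (shape D) (iota ℓ D.length F u) j c = f c := by
    intro c
    funext r
    refine eq_of_forall_lt_iff fun q => ?_
    rw [lt_rowCount_iff hT]
    have h1 := hmem (c, r, q)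
    have h2 := iotaSteps_le_iff (ℓ := ℓ) (n := D.length) (F := F) (u := u) hj.le (c, r, q)
    have h3 : iotaSteps ℓ D.length F u j (c, r, q) ≠ 0 ↔ q < f c r :=
      Set.ext_iff.mp hdiag (c, r, q)
    rw [← h3, ← h2]
    exact and_congr_left fun _ => h1.symm
  have htower : ∀ t : ℕ, 1 ≤ t → t ≤ D.length →
      towerColors (shape D) (iota ℓ D.length F u) j ((t : ℤ) - ℓ) =
        colorsAt ℓ D.length F u j t := by
    intro t ht1 htn
    ext c
    rw [mem_towerColors, hrows, hbeads]
    constructor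
    · rintro (h | ⟨t', -, -, h, h'⟩)
      · omega
      · have : t' = t := by omega
        exact this ▸ h'
    · intro h
      exact Or.inr ⟨t, ht1, htn, by ring, h⟩
  have hp : ∀ N ∈ nodesWith (shape D) (iota ℓ D.length F u) (j + 1),
      (N.2.2 : ℤ) - N.2.1 = (((F.getD j (0, 0)).1 : ℕ) : ℤ) - ℓ := by
    intro N hN
    have := ((iotaSteps_eq_succ hj).mp (mem_nodesWith.mp hN).2).2.1
    simp only [residue] at this
    omega
  have hrow := ladderRow_orientations hF hund hflow hconn hj.le
  obtain ⟨-, hs1, hs2, -⟩ := ladder_step hF hund hflow hconn hj hrow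
  have hM : stepColors (shape D) (iota ℓ D.length F u) (j + 1) =
      movedColors ℓ D.length F u j := by
    ext c
    rw [stepColors, Finset.mem_image]
    constructor
    · rintro ⟨N, hN, rfl⟩
      exact ((iotaSteps_eq_succ hj).mp (mem_nodesWith.mp hN).2).1
    · intro hcM
      have h1 := hs1 hcM
      have h2 := Finset.disjoint_left.mp hs2 hcM
      rw [← htower _ hi1 hin.le, mem_towerColors, hrows] at h1
      rw [← htower _ (by omega) hin, mem_towerColors, hrows] at h2
      obtain ⟨r, hr⟩ := mem_beads.mp h1
      have hval : iota ℓ D.length F u (c, r, f c r) = j + 1 := by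
        refine (iotaSteps_eq_succ hj).mpr ⟨hcM, ?_, ?_⟩
        · simp only [residue]
          omega
        · rw [hdiag, isAddable_rowsDiagram_iff hanti]
          refine ⟨rfl, ?_⟩
          simp only [hr]
          push_cast at h2
          convert h2 using 2
          ring
      refine ⟨(c, r, f c r), mem_nodesWith.mpr ⟨(hmem _).mp (by omega), hval⟩, rfl⟩
  have e : (((F.getD j (0, 0)).1 : ℕ) : ℤ) - ℓ + 1 =
      (((F.getD j (0, 0)).1 + 1 : ℕ) : ℤ) - ℓ := by
    push_cast
    ring
  rw [stepDegree_eq_localDeg hT hp, hM, e, htower _ hi1 hin.le, htower _ (by omega) hin]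

theorem degBKW_iota (hD : ∀ c : Fin 3, (column D c).card = ℓ) (hu : u ∈ ladderFlowWebs ℓ F D) :
    degBKW F.length (shape D) (iota ℓ D.length F u) = degWt u := by
  have hstep := fun j (hj : j < F.length) => stepDegree_iota hD hu hj
  obtain ⟨⟨-, hflow, hconn⟩, hF, hwt, hund⟩ := hu
  have hsum : ∀ k ≤ F.length, weight (u.take (ladderWeb ℓ D.length (F.take k)).length) =
      -∑ j ∈ Finset.range k, stepDegree (shape D) (iota ℓ D.length F u) (j + 1) := by
    intro k hk
    induction k with
    | zero =>
      rw [ladderWeb_take_zero]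
      simp [weight]
    | succ k ih =>
      have hrow := ladderRow_orientations hF hund hflow hconn (show k ≤ F.length by omega)
      obtain ⟨-, -, -, -, h⟩ := ladder_step hF hund hflow hconn hk hrow
      rw [h, ih (by omega), Finset.sum_range_succ, hstep k hk]
      ring
  have hlen : u.length = (ladderWeb ℓ D.length F).length := by
    rw [← hund, underlyingWeb, List.length_map]
  have := hsum F.length le_rfl
  rw [List.take_length, ← hlen, List.take_length] at this
  rw [degBKW_eq_sum, degWt, this, neg_neg]

end Ladder

end Sl3Web

theorem mainTheorem7 (ℓ : ℕ) (D : List Symbol) (hD : ∀ c : Fin 3, (column D c).card = ℓ) :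
    (∀ (F : FString) (u : List (Slice Strand)), u ∈ ladderFlowWebs ℓ F D →
      iota ℓ D.length F u ∈ Std F.length (shape D) ∧
      degBKW F.length (shape D) (iota ℓ D.length F u) = degWt u) ∧
    (∀ (k : ℕ) (T : Filling), T ∈ Std k (shape D) →
      growth k (shape D) T ∈ flowWebs D ∧
      degWt (growth k (shape D) T) = degBKW k (shape D) T) ∧
    (∀ (F : FString) (u v : List (Slice Strand)), u ∈ ladderFlowWebs ℓ F D → v ∈ flowWebs D →
      Isotopic D u v → degBKW F.length (shape D) (iota ℓ D.length F u) = degWt v) ∧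
    (∀ (F F' : FString) (u u' : List (Slice Strand)), u ∈ ladderFlowWebs ℓ F D →
      u' ∈ ladderFlowWebs ℓ F' D → Isotopic D u u' →
      degBKW F.length (shape D) (iota ℓ D.length F u) =
        degBKW F'.length (shape D) (iota ℓ D.length F' u')) ∧
    (∀ (k k' : ℕ) (T T' : Filling), T ∈ Std k (shape D) → T' ∈ Std k' (shape D) →
      Isotopic D (growth k (shape D) T) (growth k' (shape D) T') →
      degBKW k (shape D) T = degBKW k' (shape D) T') := by
  refine ⟨fun F u hu => ⟨isStandard_iota hD hu, degBKW_iota hD hu⟩,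
    fun k T hT => ⟨growth_mem_flowWebs hD hT, degWt_growth hT⟩, ?_, ?_, ?_⟩
  · intro F u v hu _ huv
    rw [degBKW_iota hD hu, degWt_eq_of_isotopic huv]
  · intro F F' u u' hu hu' huu'
    rw [degBKW_iota hD hu, degBKW_iota hD hu', degWt_eq_of_isotopic huu']
  · intro k k' T T' hT hT' h
    rw [← degWt_growth hT, ← degWt_growth hT', degWt_eq_of_isotopic h]
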